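/- Let $\mathbb K$ be a commutative ring. A quasimetric space is a set $X$ with $d:X\times X\to[0,\infty]$ satisfying the triangle inequality and $d(x,y)=0\Leftrightarrow x=y$ (symmetry is not required); morphisms are short maps ($d(\varphi x,\varphi x')\le d(x,x')$). A digraph $G$ (every vertex carrying a degenerate loop; morphisms are the vertex maps that send arrows to arrows) is regarded as a quasimetric space via the shortest path distance. For real $r\ge 0$, points $x,x'$ are $r$-homotopic if they are joined by a finite sequence in which any two consecutive points $a,b$ satisfy $d(a,b)\le r$ or $d(b,a)\le r$; short maps $X\to Y$ are $r$-homotopic if they are so as points of the space of short maps with $d(\varphi,\psi)=\sup_x d(\varphi x,\psi x)$. A functor on quasimetric spaces is an $r$-homotopy invariant if it sends $r$-homotopic maps to equal morphisms (and hence $r$-homotopy equivalent spaces to isomorphic objects). The reachability complex $\mathrm{RC}(X)$ is the chain complex of $\mathbb K$-modules with $\mathrm{RC}_n(X)$ free on the tuples $(x_0,\dots,x_n)$ with $x_i\ne x_{i+1}$ and $d(x_i,x_{i+1})<\infty$, and $\partial(x_0,\dots,x_n)=\sum_i(-1)^i(x_0,\dots,\hat x_i,\dots,x_n)$, tuples with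 consecutive repetitions being identified with $0$. For $s\in\mathbb R$, $F_s\mathrm{RC}(X)$ is spanned by the tuples with $\sum_i d(x_i,x_{i+1})\le s$. For a left infinite interval $L\subseteq\mathbb R$ (that is, $(-\infty,a)$, $(-\infty,a]$, $\emptyset$ or $\mathbb R$) put $F_L=\bigcup_{s\in L}F_s$ (with $F_\emptyset=0$). A non-empty interval $I\subseteq\mathbb R$ is uniquely $I=R\setminus L$ with $L\subseteq R$ left infinite; put $C_I=F_R/F_L$, $I_r=R\setminus(L-r)$, $I^r=(R+r)\setminus L$ for $r\ge0$. The $r$-spectral homology is $$\mathrm{SH}^r_{n,I}(X)=\frac{\mathrm{Im}\big(H_n(C_{I_r})\to H_n(C_I)\big)}{\mathrm{Ker}\big(H_n(C_I)\to H_n(C_{I^r})\big)},$$ and $\mathrm{PSH}^r_n(X)$ is the persistent module $\ell\mapsto\mathrm{SH}^r_{n,(-\infty,\ell]}(X)$, $\ell\in\mathbb R$. Magnitude homology is $\mathrm{MH}_{n,\ell}(X)=H_n(F_\ell\mathrm{RC}(X)/F_{(-\infty,\ell)}\mathrm{RC}(X))$; blurred magnitude homology $\mathrm{BMH}_n(X)$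 is the persistent module $\ell\mapsto H_n(F_\ell\mathrm{RC}(X))$; reachability homology $\mathrm{RH}_n(X)$ is the homology (of the nerve), with coefficients in $\mathbb K$, of the preorder on $X$ with $x\le y\Leftrightarrow d(x,y)<\infty$. The magnitude-path spectral sequence $E(G)$ of a digraph is the spectral sequence of $\mathrm{RC}(G)$ with the integral filtration $F_\ell$, $\ell\in\mathbb Z$, whose $r$-th page is $$E^r_{\ell,n-\ell}(G)=\frac{\mathrm{Im}\big(H_n(F_\ell/F_{\ell-r})\to H_n(F_\ell/F_{\ell-1})\big)}{\mathrm{Ker}\big(H_n(F_\ell/F_{\ell-1})\to H_n(F_{\ell+r-1}/F_{\ell-1})\big)}.$$ Path homology is $\mathrm{PH}_n(G)=H_n(\Omega_\bullet(G))$, where $\Omega_n(G)=\{u\in A_n(G):\partial u\in A_{n-1}(G)\}$ and $A_n(G)$ is the free module on the tuples of vertices $(g_0,\dots,g_n)$ such that every $(g_i,g_{i+1})$ is an arrow with $g_i\neq g_{i+1}$. **Theorem.** Let $X$ be a quasimetric space and $G$ a digraph, both arbitrary. For every $n\ge 0$ there are the following isomorphisms, natural in $X$ and in $G$. 1. For every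 $\ell\in\mathbb R$, $\mathrm{MH}_{n,\ell}(X)\cong\mathrm{SH}^0_{n,\{\ell\}}(X)$; and for every real $r\ge0$, $\mathrm{SH}^r_{n,\{\ell\}}(X)$ is (naturally in $X$) a subquotient of $\mathrm{MH}_{n,\ell}(X)$ and an $r$-homotopy invariant. 2. $\mathrm{BMH}_n(X)\cong\mathrm{PSH}^0_n(X)$ as persistent modules; and for every real $r\ge0$, $\mathrm{PSH}^r_n(X)$ is (naturally in $X$) a subquotient persistent module of $\mathrm{BMH}_n(X)$ and an $r$-homotopy invariant. 3. $\mathrm{RH}_n(X)\cong\mathrm{SH}^r_{n,\mathbb R}(X)$ for every real $r\ge0$. 4. $E^r_{\ell,n-\ell}(G)\cong\mathrm{SH}^{r-1}_{n,\{\ell\}}(G)$ for every integer $r\ge1$ and every $\ell\in\mathbb Z$. 5. $\mathrm{PH}_n(G)\cong\mathrm{SH}^1_{n,\{n\}}(G)$. -/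

import Mathlib

open CategoryTheory
open scoped ENNReal NNReal

universe u v w

noncomputable section

namespace SpectralHomology

/-! ## Quasimetric spaces, short maps, `r`-homotopy -/

/-- A quasimetric space: a set with a distance in `[0, ∞]`, not necessarily symmetric, such that
the triangle inequality holds and `d(x, y) = 0` if and only if `x = y`. -/
structure QMet where
  carrier : Type u
  dist : carrier → carrier → ℝ≥0∞
  dist_eq_zero : ∀ x y, dist x y = 0 ↔ x = y
  dist_triangle : ∀ x y z, dist x z ≤ dist x y + dist y z

namespace QMet

/-- Short (distance non-increasing) maps. -/
@[ext]
structure Hom (X Y : QMet.{u}) where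
  toFun : X.carrier → Y.carrier
  short : ∀ x x', Y.dist (toFun x) (toFun x') ≤ X.dist x x'

/-- The category of quasimetric spaces and short maps. -/
instance : Category QMet.{u} where
  Hom X Y := Hom X Y
  id X := ⟨fun x => x, fun _ _ => le_rfl⟩
  comp f g := ⟨fun x => g.toFun (f.toFun x), fun x x' => (g.short _ _).trans (f.short x x')⟩

/-- The quasimetric space `SMap(X, Y)` of short maps, with `d(φ, ψ) = sup_x d(φ x, ψ x)`. -/
def SMap (X Y : QMet.{u}) : QMet.{u} where
  carrier := X ⟶ Y
  dist φ ψ := ⨆ x : X.carrier, Y.dist (φ.toFun x) (ψ.toFun x)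
  dist_eq_zero φ ψ := by
    simp only [ENNReal.iSup_eq_zero, Y.dist_eq_zero]
    exact ⟨fun h => Hom.ext (funext h), fun h x => by rw [h]⟩
  dist_triangle φ ψ χ := iSup_le fun x => (Y.dist_triangle _ (ψ.toFun x) _).trans
    (add_le_add (le_iSup (fun x => Y.dist (φ.toFun x) (ψ.toFun x)) x)
      (le_iSup (fun x => Y.dist (ψ.toFun x) (χ.toFun x)) x))

/-- Two points are `r`-homotopic if they are joined by a finite sequence of points in which, for
any two consecutive points `a, b`, one has `d(a, b) ≤ r` or `d(b, a) ≤ r`. -/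
def PointHomotopic (X : QMet.{u}) (r : ℝ≥0) : X.carrier → X.carrier → Prop :=
  Relation.ReflTransGen fun a b => X.dist a b ≤ r ∨ X.dist b a ≤ r

/-- Two short maps are `r`-homotopic if they are `r`-homotopic as points of `SMap(X, Y)`. -/
def Homotopic (r : ℝ≥0) {X Y : QMet.{u}} (φ ψ : X ⟶ Y) : Prop :=
  (SMap X Y).PointHomotopic r φ ψ

/-- Two quasimetric spaces are `r`-homotopy equivalent if there are short maps in both directions
that are mutually inverse up to `r`-homotopy. -/
def HomotopyEquivalent (r : ℝ≥0) (X Y : QMet.{u}) : Prop :=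
  ∃ (φ : X ⟶ Y) (ψ : Y ⟶ X), Homotopic r (φ ≫ ψ) (𝟙 X) ∧ Homotopic r (ψ ≫ φ) (𝟙 Y)

/-- A functor on quasimetric spaces is an `r`-homotopy invariant if it takes equal values on
`r`-homotopic short maps, and isomorphic values on `r`-homotopy equivalent spaces. -/
def HomotopyInvariant (r : ℝ≥0) {A : Type*} [Category A] (T : QMet.{u} ⥤ A) : Prop :=
  (∀ (X Y : QMet.{u}) (φ ψ : X ⟶ Y), Homotopic r φ ψ → T.map φ = T.map ψ) ∧
  (∀ X Y : QMet.{u}, HomotopyEquivalent r X Y → Nonempty (T.obj X ≅ T.obj Y))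

end QMet

/-- `F` is a subquotient of `G`: a quotient of a subobject of `G`. -/
def IsSubquotient {A : Type*} [Category A] (F G : A) : Prop :=
  ∃ (Z : A) (i : Z ⟶ G) (p : Z ⟶ F), Mono i ∧ Epi p

/-! ## Digraphs -/

/-- Digraphs, with the convention that every vertex carries a (degenerate) loop. -/
structure Digr where
  vertex : Type u
  arrow : vertex → vertex → Prop
  arrow_refl : ∀ g, arrow g g

namespace Digr

/-- Morphisms of digraphs: maps of vertices that send arrows to (possibly degenerate) arrows. -/
@[ext]
structure Hom (G H : Digr.{u}) where
  toFun : G.vertex → H.vertex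
  map_arrow : ∀ g g', G.arrow g g' → H.arrow (toFun g) (toFun g')

instance : Category Digr.{u} where
  Hom G H := Hom G H
  id G := ⟨fun x => x, fun _ _ h => h⟩
  comp f g := ⟨fun x => g.toFun (f.toFun x), fun _ _ h => g.map_arrow _ _ (f.map_arrow _ _ h)⟩

/-- `G.HasPath n x y`: there is a path `(x = g₀, g₁, …, gₙ = y)` of length `n` in `G`. -/
def HasPath (G : Digr.{u}) : ℕ → G.vertex → G.vertex → Prop
  | 0, x, y => x = y
  | n + 1, x, y => ∃ z, G.arrow x z ∧ G.HasPath n z y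

theorem HasPath.append {G : Digr.{u}} : ∀ {m n : ℕ} {x y z : G.vertex},
    G.HasPath m x y → G.HasPath n y z → G.HasPath (m + n) x z
  | 0, n, _, _, z, h, h' => by
    have h1 : _ = _ := h
    rw [Nat.zero_add, h1]
    exact h'
  | m + 1, n, x, y, z, ⟨a, ha, h⟩, h' => by
    rw [Nat.add_right_comm]
    exact ⟨a, ha, h.append h'⟩

theorem HasPath.map {G H : Digr.{u}} (f : G ⟶ H) : ∀ {n : ℕ} {x y : G.vertex},
    G.HasPath n x y → H.HasPath n (f.toFun x) (f.toFun y)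
  | 0, _, _, h => congrArg f.toFun h
  | _ + 1, _, _, ⟨a, ha, h⟩ => ⟨f.toFun a, f.map_arrow _ _ ha, h.map f⟩

/-- The shortest path distance: the infimum of the lengths of the paths from `x` to `y`. -/
def pathDist (G : Digr.{u}) (x y : G.vertex) : ℝ≥0∞ :=
  ⨅ (n : ℕ) (_ : G.HasPath n x y), (n : ℝ≥0∞)

/-- The functor that sends a digraph to its set of vertices with the shortest path distance. -/
def toQMet : Digr.{u} ⥤ QMet.{u} where
  obj G :=
    { carrier := G.vertex
      dist := G.pathDist
      dist_eq_zero := fun x y => by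
        constructor
        · intro h
          by_contra hxy
          have h1 : (1 : ℝ≥0∞) ≤ G.pathDist x y := by
            refine le_iInf₂ fun n hn => ?_
            cases n with
            | zero => exact absurd hn hxy
            | succ n => exact_mod_cast Nat.succ_le_succ (Nat.zero_le n)
          rw [h] at h1
          exact absurd h1 (by simp)
        · rintro rfl
          have h0 : G.HasPath 0 x x := rfl
          exact le_antisymm ((iInf₂_le 0 h0).trans (by simp)) zero_le
      dist_triangle := fun x y z => by
        simp only [pathDist, ENNReal.iInf_add, ENNReal.add_iInf]
        refine le_iInf₂ fun m hm => le_iInf₂ fun n hn => ?_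
        exact (iInf₂_le (n + m) (hn.append hm)).trans (by push_cast; exact le_rfl) }
  map f := ⟨f.toFun, fun x x' => le_iInf₂ fun n hn => iInf₂_le n (hn.map f)⟩

end Digr

/-! ## Subquotients of modules -/

section Modules

variable {K : Type v} [CommRing K]
variable {M : Type*} [AddCommGroup M] [Module K M]
variable {M' : Type*} [AddCommGroup M'] [Module K M']

/-- The module `S / (S ∩ T)`; this is `S / T` when `T ≤ S`. -/
abbrev SQ (S T : Submodule K M) : Type _ := S ⧸ T.submoduleOf S

/-- The map `S / T → S' / T'` induced by a linear map that sends `S` to `S'` and `T` to `T'`. -/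
def sqMap (f : M →ₗ[K] M') (S T : Submodule K M) (S' T' : Submodule K M')
    (hS : S ≤ S'.comap f) (hT : T ≤ T'.comap f) : SQ S T →ₗ[K] SQ S' T' :=
  Submodule.mapQ _ _ (f.restrict fun _ hx => hS hx) fun _ hx => hT hx

theorem sq_hom_ext {S T : Submodule K M} {f g : SQ S T →ₗ[K] M'}
    (h : ∀ x : S, f (Submodule.Quotient.mk x) = g (Submodule.Quotient.mk x)) : f = g := by
  refine LinearMap.ext fun x => ?_
  obtain ⟨x, rfl⟩ := Submodule.Quotient.mk_surjective _ x
  exact h x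

end Modules

/-- For natural transformations `f : A ⟶ B` and `g : B ⟶ D` of functors to `K`-modules: the functor
`j ↦ Im(f j) / Ker(g j)`, a subquotient of `B` (here `Ker(g j)` is intersected with `Im(f j)`). -/
def imModKer {K : Type v} [CommRing K] {J : Type*} [Category J] {A B D : J ⥤ ModuleCat.{w} K}
    (f : A ⟶ B) (g : B ⟶ D) : J ⥤ ModuleCat.{w} K where
  obj j := ModuleCat.of K (SQ (LinearMap.range (f.app j).hom) (LinearMap.ker (g.app j).hom))
  map {i j} φ := ModuleCat.ofHom (sqMap (B.map φ).hom _ _ _ _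
    (by
      rintro _ ⟨x, rfl⟩
      exact ⟨(A.map φ).hom x, congrArg (fun h => h.hom x) (f.naturality φ)⟩)
    (by
      intro x hx
      have h1 := congrArg (fun h => h.hom x) (g.naturality φ)
      simp only [ModuleCat.hom_comp, LinearMap.comp_apply] at h1
      simp only [Submodule.mem_comap, LinearMap.mem_ker] at hx ⊢
      rw [h1, hx, map_zero]))
  map_id j := ModuleCat.hom_ext <| sq_hom_ext fun x => congrArg Submodule.Quotient.mk <|
    Subtype.ext (congrArg (fun h => h.hom x.1) (B.map_id j))
  map_comp φ ψ := ModuleCat.hom_ext <| sq_hom_ext fun x => congrArg Submodule.Quotient.mk <|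
    Subtype.ext (congrArg (fun h => h.hom x.1) (B.map_comp φ ψ))

/-! ## Chain complexes: subcomplexes and their quotients -/

section Complexes

variable {K : Type v} [CommRing K]

/-- A chain subcomplex. -/
structure Subcx (C : ChainComplex (ModuleCat.{w} K) ℕ) where
  mod : ∀ n : ℕ, Submodule K (C.X n)
  d_mem : ∀ i j : ℕ, mod i ≤ (mod j).comap (C.d i j).hom

namespace Subcx

variable {C D E : ChainComplex (ModuleCat.{w} K) ℕ}

/-- A subcomplex as a chain complex. -/
def cx (S : Subcx C) : ChainComplex (ModuleCat.{w} K) ℕ where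
  X n := ModuleCat.of K (S.mod n)
  d i j := ModuleCat.ofHom ((C.d i j).hom.restrict fun _ hx => S.d_mem i j hx)
  shape i j h := ModuleCat.hom_ext <| LinearMap.ext fun x =>
    Subtype.ext (congrArg (fun k => k.hom x.1) (C.shape i j h))
  d_comp_d' i j k _ _ := ModuleCat.hom_ext <| LinearMap.ext fun x =>
    Subtype.ext (congrArg (fun k => k.hom x.1) (C.d_comp_d i j k))

/-- The quotient complex `S / T` of two subcomplexes `T ⊆ S`. -/
def quot (S T : Subcx C) : ChainComplex (ModuleCat.{w} K) ℕ where
  X n := ModuleCat.of K (SQ (S.mod n) (T.mod n))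
  d i j := ModuleCat.ofHom (sqMap (C.d i j).hom _ _ _ _ (S.d_mem i j) (T.d_mem i j))
  shape i j h := ModuleCat.hom_ext <| sq_hom_ext fun x => congrArg Submodule.Quotient.mk <|
    Subtype.ext (congrArg (fun k => k.hom x.1) (C.shape i j h))
  d_comp_d' i j k _ _ := ModuleCat.hom_ext <| sq_hom_ext fun x => congrArg Submodule.Quotient.mk <|
    Subtype.ext (congrArg (fun k => k.hom x.1) (C.d_comp_d i j k))

/-- The chain map `φ` sends the subcomplex `S` into the subcomplex `S'`. -/
def MapsTo (φ : C ⟶ D) (S : Subcx C) (S' : Subcx D) : Prop :=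
  ∀ n, S.mod n ≤ (S'.mod n).comap (φ.f n).hom

theorem MapsTo.comp {φ : C ⟶ D} {ψ : D ⟶ E} {S : Subcx C} {S' : Subcx D} {S'' : Subcx E}
    (h : MapsTo φ S S') (h' : MapsTo ψ S' S'') : MapsTo (φ ≫ ψ) S S'' :=
  fun n _ hx => h' n (h n hx)

/-- The chain map between subcomplexes induced by a chain map. -/
def cxMap (φ : C ⟶ D) {S : Subcx C} {S' : Subcx D} (h : MapsTo φ S S') : S.cx ⟶ S'.cx where
  f n := ModuleCat.ofHom ((φ.f n).hom.restrict fun _ hx => h n hx)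
  comm' i j _ := ModuleCat.hom_ext <| LinearMap.ext fun x =>
    Subtype.ext (congrArg (fun k => k.hom x.1) (φ.comm i j))

/-- The chain map `S / T ⟶ S' / T'` induced by a chain map. -/
def quotMap (φ : C ⟶ D) {S T : Subcx C} {S' T' : Subcx D} (hS : MapsTo φ S S')
    (hT : MapsTo φ T T') : S.quot T ⟶ S'.quot T' where
  f n := ModuleCat.ofHom (sqMap (φ.f n).hom _ _ _ _ (hS n) (hT n))
  comm' i j _ := ModuleCat.hom_ext <| sq_hom_ext fun x => congrArg Submodule.Quotient.mk <|
    Subtype.ext (congrArg (fun k => k.hom x.1) (φ.comm i j))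

theorem quotMap_id {S T : Subcx C} (hS : MapsTo (𝟙 C) S S) (hT : MapsTo (𝟙 C) T T) :
    quotMap (𝟙 C) hS hT = 𝟙 _ :=
  HomologicalComplex.hom_ext _ _ fun _ => ModuleCat.hom_ext (sq_hom_ext fun _ => rfl)

theorem quotMap_comp (φ : C ⟶ D) (ψ : D ⟶ E) {S T : Subcx C} {S' T' : Subcx D}
    {S'' T'' : Subcx E} (hS : MapsTo φ S S') (hT : MapsTo φ T T')
    (hS' : MapsTo ψ S' S'') (hT' : MapsTo ψ T' T'')
    (hS'' : MapsTo (φ ≫ ψ) S S'') (hT'' : MapsTo (φ ≫ ψ) T T'') :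
    quotMap (φ ≫ ψ) hS'' hT'' = quotMap φ hS hT ≫ quotMap ψ hS' hT' :=
  HomologicalComplex.hom_ext _ _ fun _ =>
    ModuleCat.hom_ext (sq_hom_ext fun _ => rfl)

/-- The subcomplex `{u ∈ A : ∂u ∈ A}` of a complex, for a graded submodule `A`. -/
def core (A : ∀ n : ℕ, Submodule K (C.X n)) : Subcx C where
  mod n := A n ⊓ ⨅ m : ℕ, (A m).comap (C.d n m).hom
  d_mem i j x hx := by
    simp only [Submodule.mem_inf, Submodule.mem_iInf, Submodule.mem_comap] at hx ⊢
    refine ⟨hx.2 j, fun m => ?_⟩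
    have h0 : (C.d j m).hom ((C.d i j).hom x) = 0 :=
      congrArg (fun h => h.hom x) (C.d_comp_d i j m)
    rw [h0]
    exact zero_mem _

end Subcx

/-! ## Filtered complexes -/

variable (K) in
/-- Chain complexes with an increasing filtration indexed by `ι` (here `ι = ℝ` or `ι = ℤ`). -/
structure FiltCx (ι : Type) [Preorder ι] where
  cx : ChainComplex (ModuleCat.{w} K) ℕ
  F : ι → Subcx cx
  mono : ∀ {a b : ι}, a ≤ b → ∀ n, (F a).mod n ≤ (F b).mod n

namespace FiltCx

variable {ι : Type} [Preorder ι]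

/-- Chain maps that preserve the filtrations. -/
@[ext]
structure Hom (C D : FiltCx.{v, w} K ι) where
  map : C.cx ⟶ D.cx
  mapsTo : ∀ a : ι, Subcx.MapsTo map (C.F a) (D.F a)

instance : Category (FiltCx.{v, w} K ι) where
  Hom C D := Hom C D
  id _ := ⟨𝟙 _, fun _ _ _ hx => hx⟩
  comp f g := ⟨f.map ≫ g.map, fun a => (f.mapsTo a).comp (g.mapsTo a)⟩
  id_comp f := Hom.ext (Category.id_comp f.map)
  comp_id f := Hom.ext (Category.comp_id f.map)
  assoc f g h := Hom.ext (Category.assoc f.map g.map h.map)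

/-- The functor `C ↦ F_a C / F_b C`. -/
def gr (a b : ι) : FiltCx.{v, w} K ι ⥤ ChainComplex (ModuleCat.{w} K) ℕ where
  obj C := (C.F a).quot (C.F b)
  map f := Subcx.quotMap f.map (f.mapsTo a) (f.mapsTo b)
  map_id _ := Subcx.quotMap_id _ _
  map_comp f g := Subcx.quotMap_comp f.map g.map _ _ _ _ _ _

/-- The map `F_a C / F_b C ⟶ F_a' C / F_b' C` induced by the inclusions. -/
def grMap {a b a' b' : ι} (ha : a ≤ a') (hb : b ≤ b') :
    (gr a b : FiltCx.{v, w} K ι ⥤ ChainComplex (ModuleCat.{w} K) ℕ) ⟶ gr a' b' where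
  app C := Subcx.quotMap (𝟙 C.cx) (fun n _ hx => C.mono ha n hx) (fun n _ hx => C.mono hb n hx)
  naturality _ _ _ := HomologicalComplex.hom_ext _ _ fun _ =>
    ModuleCat.hom_ext (sq_hom_ext fun _ => rfl)

/-- The functor `(C, a) ↦ F_a C`. -/
def stage : FiltCx.{v, w} K ι × ι ⥤ ChainComplex (ModuleCat.{w} K) ℕ where
  obj p := (p.1.F p.2).cx
  map {p q} f := Subcx.cxMap f.1.map fun n _ hx => q.1.mono (leOfHom f.2) n (f.1.mapsTo p.2 n hx)
  map_id _ := rfl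
  map_comp _ _ := rfl

/-- The union `F_L C` of the `F_a C` for `a` in a left infinite interval `L ⊆ ℝ`
(the supremum is directed; it is `0` for `L = ∅`). -/
def FL (C : FiltCx.{v, w} K ℝ) (L : LowerSet ℝ) : Subcx C.cx where
  mod n := ⨆ a : L, (C.F a.1).mod n
  d_mem i j := iSup_le fun a => ((C.F a.1).d_mem i j).trans
    (Submodule.comap_mono (le_iSup (fun a : L => (C.F a.1).mod j) a))

theorem FL_mapsTo {C D : FiltCx.{v, w} K ℝ} (f : C ⟶ D) {L L' : LowerSet ℝ} (h : L ≤ L') :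
    Subcx.MapsTo f.map (C.FL L) (D.FL L') := fun n =>
  iSup_le fun a => (f.mapsTo a.1 n).trans
    (Submodule.comap_mono (le_iSup (fun a : L' => (D.F a.1).mod n) ⟨a.1, h a.2⟩))

/-- The restriction of an `ℝ`-filtration to integer indices. -/
def toInt : FiltCx.{v, w} K ℝ ⥤ FiltCx.{v, w} K ℤ where
  obj C := { cx := C.cx, F := fun ℓ => C.F ℓ, mono := fun h => C.mono (Int.cast_le.2 h) }
  map f := { map := f.map, mapsTo := fun ℓ => f.mapsTo ℓ }
  map_id _ := rfl
  map_comp _ _ := rfl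

end FiltCx

/-! ## Intervals and spectral homology -/

/-- A pair of left infinite intervals `R`, `L` of `ℝ`. A non-empty interval `I ⊆ ℝ` is handled
through its unique presentation `I = R \ L` with `L ⊆ R` left infinite intervals. -/
structure Ivl where
  R : LowerSet ℝ
  L : LowerSet ℝ

namespace Ivl

/-- The order `I ≼ J`, meaning `R_I ⊆ R_J` and `L_I ⊆ L_J`. -/
instance : Preorder Ivl where
  le I J := I.R ≤ J.R ∧ I.L ≤ J.L
  le_refl _ := ⟨le_rfl, le_rfl⟩
  le_trans _ _ _ h h' := ⟨h.1.trans h'.1, h.2.trans h'.2⟩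

/-- The presentation of a non-empty interval `I ⊆ ℝ`:
`R_I = {x | ∃ i ∈ I, x ≤ i}` and `L_I = {x | ∀ i ∈ I, x < i}`. -/
def pres (I : Set ℝ) : Ivl where
  R := ⟨{x | ∃ i ∈ I, x ≤ i}, fun _ _ h ⟨i, hi, h'⟩ => ⟨i, hi, h.trans h'⟩⟩
  L := ⟨{x | ∀ i ∈ I, x < i}, fun _ _ h h' i hi => h.trans_lt (h' i hi)⟩

/-- The translate `L + t` of a left infinite interval. -/
def shift (L : LowerSet ℝ) (t : ℝ) : LowerSet ℝ :=
  ⟨{x | x - t ∈ L}, fun _ _ h h' => L.lower (sub_le_sub_right h t) h'⟩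

theorem le_shift (L : LowerSet ℝ) (t : ℝ≥0) : L ≤ shift L t :=
  fun _ hx => L.lower (sub_le_self _ t.2) hx

theorem shift_neg_le (L : LowerSet ℝ) (t : ℝ≥0) : shift L (-t) ≤ L := fun x hx =>
  L.lower (by have := t.2; linarith [NNReal.coe_nonneg t]) (show x - -(t : ℝ) ∈ L from hx)

theorem shift_mono {L L' : LowerSet ℝ} (h : L ≤ L') (t : ℝ) : shift L t ≤ shift L' t :=
  fun _ hx => h hx

/-- The interval `I_r = R \ (L - r)`. -/
def lo (r : ℝ≥0) : Ivl ⥤ Ivl where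
  obj I := ⟨I.R, shift I.L (-r)⟩
  map f := homOfLE ⟨(leOfHom f).1, shift_mono (leOfHom f).2 _⟩

/-- The interval `I^r = (R + r) \ L`. -/
def hi (r : ℝ≥0) : Ivl ⥤ Ivl where
  obj I := ⟨shift I.R r, I.L⟩
  map f := homOfLE ⟨shift_mono (leOfHom f).1 _, (leOfHom f).2⟩

/-- `I_r ≼ I`. -/
def fromLo (r : ℝ≥0) : lo r ⟶ 𝟭 Ivl where
  app I := homOfLE ⟨le_rfl, shift_neg_le I.L r⟩

/-- `I ≼ I^r`. -/
def toHi (r : ℝ≥0) : 𝟭 Ivl ⟶ hi r where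
  app I := homOfLE ⟨le_shift I.R r, le_rfl⟩

/-- `lo r` sends the presentation of `I = R \ L` to that of the set `R \ (L - r)`. -/
theorem lo_pres (r : ℝ≥0) {I : Set ℝ} (hI : I.Nonempty) :
    pres {x | x ∈ (pres I).R ∧ x + r ∉ (pres I).L} = (lo r).obj (pres I) := by
  obtain ⟨i₀, hi₀⟩ := hI
  have hr : (0 : ℝ) ≤ r := r.2
  have key : ∀ i ∈ I, i ∈ (pres I).R ∧ i + r ∉ (pres I).L := fun i hi =>
    ⟨⟨i, hi, le_rfl⟩, fun h => absurd (h i hi) (by linarith)⟩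
  have hR : (pres {x | x ∈ (pres I).R ∧ x + r ∉ (pres I).L}).R = (pres I).R := by
    refine LowerSet.ext (Set.ext fun x => ⟨?_, ?_⟩)
    · rintro ⟨i, ⟨hi, -⟩, hx⟩
      exact (pres I).R.lower hx hi
    · rintro ⟨i, hi, hx⟩
      exact ⟨i, key i hi, hx⟩
  have hL : (pres {x | x ∈ (pres I).R ∧ x + r ∉ (pres I).L}).L = shift (pres I).L (-r) := by
    refine LowerSet.ext (Set.ext fun x => ⟨?_, ?_⟩)
    · intro hx
      by_contra hx'
      have hx2 : x + r ∉ (pres I).L := fun h => hx' (by simpa [shift] using h)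
      exact lt_irrefl x (hx x ⟨⟨i₀, hi₀, (hx i₀ (key i₀ hi₀)).le⟩, hx2⟩)
    · rintro hx i ⟨-, hi⟩
      by_contra hlt
      exact hi ((pres I).L.lower (by linarith) (show x - -(r : ℝ) ∈ (pres I).L from hx))
  exact congrArg₂ Ivl.mk hR hL

/-- `hi r` sends the presentation of `I = R \ L` to that of the set `(R + r) \ L`. -/
theorem hi_pres (r : ℝ≥0) (I : Set ℝ) :
    pres {x | x - r ∈ (pres I).R ∧ x ∉ (pres I).L} = (hi r).obj (pres I) := by
  have hr : (0 : ℝ) ≤ r := r.2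
  have hR : (pres {x | x - r ∈ (pres I).R ∧ x ∉ (pres I).L}).R = shift (pres I).R r := by
    refine LowerSet.ext (Set.ext fun x => ⟨?_, ?_⟩)
    · rintro ⟨i, ⟨hi, -⟩, hx⟩
      exact (pres I).R.lower (sub_le_sub_right hx _) hi
    · rintro ⟨i, hi, hx⟩
      exact ⟨i + r, ⟨⟨i, hi, by linarith⟩, fun h => absurd (h i hi) (by linarith)⟩, by linarith⟩
  have hL : (pres {x | x - r ∈ (pres I).R ∧ x ∉ (pres I).L}).L = (pres I).L := by
    refine LowerSet.ext (Set.ext fun x => ⟨?_, ?_⟩)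
    · intro hx i hi
      exact hx i ⟨⟨i, hi, by linarith⟩, fun h => lt_irrefl i (h i hi)⟩
    · rintro hx i ⟨-, hi⟩
      by_contra hlt
      exact hi ((pres I).L.lower (not_lt.1 hlt) hx)
  exact congrArg₂ Ivl.mk hR hL

/-- The functor `ℓ ↦ (-∞, ℓ]`. -/
def iic : ℝ ⥤ Ivl where
  obj ℓ := pres (Set.Iic ℓ)
  map {ℓ ℓ'} f := homOfLE
    ⟨fun _ ⟨i, hi, h⟩ => ⟨i, le_trans hi (leOfHom f), h⟩,
      fun x hx => absurd (hx (min x ℓ) (min_le_right x ℓ)) (not_lt.2 (min_le_left x ℓ))⟩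

end Ivl

variable (K) in
/-- The functor `(C, I) ↦ C_I = F_R C / F_L C`, where `I = R \ L`. -/
def cxIvl : FiltCx.{v, w} K ℝ × Ivl ⥤ ChainComplex (ModuleCat.{w} K) ℕ where
  obj p := (p.1.FL p.2.R).quot (p.1.FL p.2.L)
  map f := Subcx.quotMap f.1.map (FiltCx.FL_mapsTo f.1 (leOfHom f.2).1)
    (FiltCx.FL_mapsTo f.1 (leOfHom f.2).2)
  map_id _ := Subcx.quotMap_id _ _
  map_comp f g := Subcx.quotMap_comp f.1.map g.1.map _ _ _ _ _ _

variable (K) in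
/-- The `n`-th homology functor on chain complexes of `K`-modules. -/
abbrev Hn (n : ℕ) : ChainComplex (ModuleCat.{w} K) ℕ ⥤ ModuleCat.{w} K :=
  HomologicalComplex.homologyFunctor _ _ n

variable (K) in
/-- The comparison `I_r ≼ I`, in the presence of a filtered complex. -/
def loHom (r : ℝ≥0) : (𝟭 (FiltCx.{v, w} K ℝ)).prod (Ivl.lo r) ⟶ 𝟭 (FiltCx.{v, w} K ℝ × Ivl) where
  app p := (𝟙 p.1, (Ivl.fromLo r).app p.2)
  naturality _ _ f := Prod.ext ((Category.comp_id f.1).trans (Category.id_comp f.1).symm) rfl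

variable (K) in
/-- The comparison `I ≼ I^r`, in the presence of a filtered complex. -/
def hiHom (r : ℝ≥0) : 𝟭 (FiltCx.{v, w} K ℝ × Ivl) ⟶ (𝟭 (FiltCx.{v, w} K ℝ)).prod (Ivl.hi r) where
  app p := (𝟙 p.1, (Ivl.toHi r).app p.2)
  naturality _ _ f := Prod.ext ((Category.comp_id f.1).trans (Category.id_comp f.1).symm) rfl

variable (K) in
/-- The `r`-spectral homology `SH^r_{n,I}(C) = SZ^r_{n,I}(C) / SB^r_{n,I}(C)`, with
`SZ^r_{n,I}(C) = Im(H_n(C_{I_r}) → H_n(C_I))` and `SB^r_{n,I}(C) = Ker(H_n(C_I) → H_n(C_{I^r}))`,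
as a functor of the filtered complex `C` and of the interval `I`. -/
def SHC (r : ℝ≥0) (n : ℕ) : FiltCx.{v, w} K ℝ × Ivl ⥤ ModuleCat.{w} K :=
  imModKer (Functor.whiskerRight (loHom.{v, w} K r) (cxIvl.{v, w} K ⋙ Hn.{v, w} K n))
    (Functor.whiskerRight (hiHom.{v, w} K r) (cxIvl.{v, w} K ⋙ Hn.{v, w} K n))

/-! ## The spectral sequence of a `ℤ`-filtered complex -/

variable (K) in
/-- The term `E^r_{ℓ,n-ℓ}` (filtration degree `ℓ`, total degree `n`) of the `r`-th page, `r ≥ 1`, of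
the spectral sequence of a `ℤ`-filtered complex, `E^r_{ℓ,n-ℓ} = Z^r_{ℓ,n-ℓ} / B^r_{ℓ,n-ℓ}` with
`Z^r_{ℓ,n-ℓ} = Im(H_n(F_ℓ/F_{ℓ-r}) → H_n(F_ℓ/F_{ℓ-1}))` and
`B^r_{ℓ,n-ℓ} = Ker(H_n(F_ℓ/F_{ℓ-1}) → H_n(F_{ℓ+r-1}/F_{ℓ-1}))`. -/
def ssPage (r : ℕ) (hr : 1 ≤ r) (n : ℕ) (ℓ : ℤ) : FiltCx.{v, w} K ℤ ⥤ ModuleCat.{w} K :=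
  imModKer
    (Functor.whiskerRight (FiltCx.grMap (a := ℓ) (b := ℓ - r) (a' := ℓ) (b' := ℓ - 1)
      le_rfl (by lia)) (Hn K n))
    (Functor.whiskerRight (FiltCx.grMap (a := ℓ) (b := ℓ - 1) (a' := ℓ + r - 1) (b' := ℓ - 1)
      (by lia) le_rfl) (Hn K n))

end Complexes

/-! ## The reachability complex -/

section RC

/-- A generator of `RC_n(X)`: a tuple `(x₀, …, xₙ)` without consecutive repetitions and with
`d(xᵢ, xᵢ₊₁) < ∞`. -/
def IsRegular (X : QMet.{u}) {n : ℕ} (x : Fin (n + 1) → X.carrier) : Prop :=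
  ∀ i : Fin n, x i.castSucc ≠ x i.succ ∧ X.dist (x i.castSucc) (x i.succ) < ∞

/-- The set of generators of `RC_n(X)`. -/
abbrev RTuple (X : QMet.{u}) (n : ℕ) : Type u :=
  {x : Fin (n + 1) → X.carrier // IsRegular X x}

/-- The length `L(x₀, …, xₙ) = ∑ d(xᵢ, xᵢ₊₁)`. -/
def len (X : QMet.{u}) {n : ℕ} (x : Fin (n + 1) → X.carrier) : ℝ≥0∞ :=
  ∑ i : Fin n, X.dist (x i.castSucc) (x i.succ)

variable (K : Type v) [CommRing K]

open Classical in
/-- The chain of a tuple of points at finite consecutive distances: the corresponding generator,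
or `0` if the tuple has a consecutive repetition. -/
def tup (X : QMet.{u}) {n : ℕ} (x : Fin (n + 1) → X.carrier) : RTuple X n →₀ K :=
  if h : IsRegular X x then Finsupp.single ⟨x, h⟩ 1 else 0

/-- The differential `∂(x₀, …, xₙ₊₁) = ∑ (-1)^i (x₀, …, x̂ᵢ, …, xₙ₊₁)`. -/
def rcD (X : QMet.{u}) (n : ℕ) : (RTuple X (n + 1) →₀ K) →ₗ[K] (RTuple X n →₀ K) :=
  Finsupp.linearCombination K fun x : RTuple X (n + 1) =>
    ∑ i : Fin (n + 2), (-1 : K) ^ (i : ℕ) • tup K X (i.removeNth x.1)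

/-- The map `(x₀, …, xₙ) ↦ (φ x₀, …, φ xₙ)`. -/
def rcMap {X Y : QMet.{u}} (φ : X ⟶ Y) (n : ℕ) : (RTuple X n →₀ K) →ₗ[K] (RTuple Y n →₀ K) :=
  Finsupp.linearCombination K fun x : RTuple X n => tup K Y fun i => φ.toFun (x.1 i)


variable {X Y : QMet.{u}}

theorem len_succ {n : ℕ} (x : Fin (n + 2) → X.carrier) :
    len X x = X.dist (x 0) (x 1) + len X (fun i : Fin (n + 1) => x i.succ) := by
  simp only [len]
  rw [Fin.sum_univ_succ]
  rfl

theorem len_removeNth : ∀ {n : ℕ} (x : Fin (n + 2) → X.carrier) (i : Fin (n + 2)),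
    len X (i.removeNth x) ≤ len X x
  | 0, x, i => by simp [len]
  | n + 1, x, i => by
    refine Fin.cases ?_ (fun j => ?_) i
    · rw [len_succ x]
      exact le_add_self
    · rw [len_succ x, len_succ (j.succ.removeNth x)]
      have h0 : j.succ.removeNth x 0 = x 0 := by simp [Fin.removeNth]
      have ht : (fun k : Fin (n + 1) => j.succ.removeNth x k.succ) =
          j.removeNth (fun k : Fin (n + 2) => x k.succ) := by
        funext k
        simp [Fin.removeNth]
      rw [h0, ht]
      by_cases hj : j = 0
      · subst hj
        have h1 : (0 : Fin (n + 2)).succ.removeNth x 1 = x 2 := rfl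
        rw [h1, len_succ (fun k : Fin (n + 2) => x k.succ), ← add_assoc]
        exact add_le_add (X.dist_triangle _ _ _) le_rfl
      · have h1 : j.succ.removeNth x 1 = x 1 := by
          obtain ⟨k, rfl⟩ := Fin.exists_succ_eq.2 hj
          exact congrArg x (Fin.succAbove_of_castSucc_lt _ _ (by simp [Fin.lt_def]))
        rw [h1]
        exact add_le_add le_rfl (len_removeNth _ j)

theorem len_comp (φ : X ⟶ Y) {n : ℕ} (x : Fin (n + 1) → X.carrier) :
    len Y (fun i => φ.toFun (x i)) ≤ len X x :=
  Finset.sum_le_sum fun _ _ => φ.short _ _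

theorem isRegular_iff {n : ℕ} (x : Fin (n + 1) → X.carrier) :
    IsRegular X x ↔ (∀ i : Fin n, x i.castSucc ≠ x i.succ) ∧ len X x < ∞ := by
  simp only [IsRegular, len, ENNReal.sum_lt_top, Finset.mem_univ, true_implies, forall_and]

theorem not_isRegular_removeNth {n : ℕ} {x : Fin (n + 2) → X.carrier} {i : Fin (n + 1)}
    (h : x i.castSucc = x i.succ) {j : Fin (n + 2)} (h1 : j ≠ i.castSucc) (h2 : j ≠ i.succ) :
    ¬ IsRegular X (j.removeNth x) := by
  intro hreg
  have h1' : (j : ℕ) ≠ i := fun e => h1 (Fin.ext e)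
  have h2' : (j : ℕ) ≠ i + 1 := fun e => h2 (Fin.ext e)
  have hi := i.2
  have hj := j.2
  rcases lt_or_ge (j : ℕ) i with hlt | hge
  · have e1 : j.succAbove (Fin.castSucc (⟨i - 1, by lia⟩ : Fin n)) = i.castSucc := by
      rw [Fin.succAbove_of_le_castSucc _ _ (by simp [Fin.le_def]; lia)]
      ext
      simp
      lia
    have e2 : j.succAbove (Fin.succ (⟨i - 1, by lia⟩ : Fin n)) = i.succ := by
      rw [Fin.succAbove_of_le_castSucc _ _ (by simp [Fin.le_def]; lia)]
      ext
      simp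
      lia
    refine (hreg ⟨i - 1, by lia⟩).1 ?_
    simp only [Fin.removeNth, e1, e2, h]
  · have e1 : j.succAbove (Fin.castSucc (⟨i, by lia⟩ : Fin n)) = i.castSucc := by
      rw [Fin.succAbove_of_castSucc_lt _ _ (by simp [Fin.lt_def]; lia)]
      rfl
    have e2 : j.succAbove (Fin.succ (⟨i, by lia⟩ : Fin n)) = i.succ := by
      rw [Fin.succAbove_of_castSucc_lt _ _ (by simp [Fin.lt_def]; lia)]
      rfl
    refine (hreg ⟨i, by lia⟩).1 ?_
    simp only [Fin.removeNth, e1, e2, h]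

theorem tup_of_regular {n : ℕ} {x : Fin (n + 1) → X.carrier} (h : IsRegular X x) :
    tup K X x = Finsupp.single ⟨x, h⟩ 1 := dif_pos h

theorem tup_of_not_regular {n : ℕ} {x : Fin (n + 1) → X.carrier} (h : ¬ IsRegular X x) :
    tup K X x = 0 := dif_neg h

theorem rcD_tup {n : ℕ} {x : Fin (n + 2) → X.carrier} (hx : len X x < ∞) :
    rcD K X n (tup K X x) = ∑ i : Fin (n + 2), (-1 : K) ^ (i : ℕ) • tup K X (i.removeNth x) := by
  by_cases h : IsRegular X x
  · rw [tup_of_regular K h, rcD, Finsupp.linearCombination_single, one_smul]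
  · rw [tup_of_not_regular K h, map_zero]
    obtain ⟨i, hi⟩ : ∃ i : Fin (n + 1), x i.castSucc = x i.succ := by
      by_contra hne
      exact h ((isRegular_iff x).2 ⟨fun i e => hne ⟨i, e⟩, hx⟩)
    have hne : i.castSucc ≠ i.succ := i.castSucc_lt_succ.ne
    rw [← Finset.sum_subset (Finset.subset_univ {i.castSucc, i.succ}), Finset.sum_pair hne]
    · have e : i.castSucc.removeNth x = i.succ.removeNth x := by
        funext k
        rcases lt_trichotomy (k : ℕ) i with hk | hk | hk
        · simp only [Fin.removeNth]
          rw [Fin.succAbove_of_castSucc_lt i.castSucc k (Fin.lt_def.2 (show (k : ℕ) < i from hk)),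
            Fin.succAbove_of_castSucc_lt i.succ k (Fin.lt_def.2 (show (k : ℕ) < i + 1 by lia))]
        · have hk' : k = i := Fin.ext hk
          subst hk'
          simp only [Fin.removeNth, Fin.succAbove_castSucc_self, Fin.succAbove_succ_self, hi]
        · simp only [Fin.removeNth]
          rw [Fin.succAbove_of_le_castSucc i.castSucc k (Fin.le_def.2 (show (i : ℕ) ≤ k from hk.le)),
            Fin.succAbove_of_le_castSucc i.succ k (Fin.le_def.2 (show (i : ℕ) + 1 ≤ k from hk))]
      rw [e, ← add_smul, Fin.val_castSucc, Fin.val_succ, pow_succ]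
      simp
    · intro j _ hj
      simp only [Finset.mem_insert, Finset.mem_singleton, not_or] at hj
      rw [tup_of_not_regular K (not_isRegular_removeNth hi hj.1 hj.2), smul_zero]

theorem sum_removeNth_removeNth {α M : Type*} [AddCommGroup M] [Module K M] {n : ℕ}
    (T : (Fin n → α) → M) (x : Fin (n + 2) → α) :
    ∑ i : Fin (n + 2), ∑ j : Fin (n + 1),
      (-1 : K) ^ (i : ℕ) • (-1 : K) ^ (j : ℕ) • T (j.removeNth (i.removeNth x)) = 0 := by
  rw [← Finset.sum_product', Finset.univ_product_univ]
  refine Finset.sum_involution (fun p _ => (p.1.succAbove p.2, p.2.predAbove p.1))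
    ?_ ?_ (fun _ _ => Finset.mem_univ _) ?_
  · rintro ⟨i, j⟩ -
    have e : (j.predAbove i).removeNth ((i.succAbove j).removeNth x) =
        j.removeNth (i.removeNth x) := by
      funext k
      simp only [Fin.removeNth, Fin.succAbove_succAbove_succAbove_predAbove]
    simp only [e, smul_smul, ← pow_add, Fin.neg_one_pow_succAbove_add_predAbove, neg_smul]
    exact add_neg_cancel _
  · rintro ⟨i, j⟩ - - h
    exact Fin.succAbove_ne i j (congrArg Prod.fst h)
  · rintro ⟨i, j⟩ -
    exact Prod.ext (Fin.succAbove_succAbove_predAbove i j) (Fin.predAbove_predAbove_succAbove i j)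

theorem rcD_comp (n : ℕ) : rcD K X n ∘ₗ rcD K X (n + 1) = 0 := by
  refine Finsupp.lhom_ext' fun x => LinearMap.ext_ring ?_
  have hx : len X x.1 < ∞ := ((isRegular_iff x.1).1 x.2).2
  simp only [LinearMap.comp_apply, Finsupp.lsingle_apply, LinearMap.zero_apply]
  rw [← tup_of_regular K x.2, rcD_tup K hx, map_sum]
  simp only [map_smul]
  refine Eq.trans (Finset.sum_congr rfl fun i _ => ?_) (sum_removeNth_removeNth K (tup K X) x.1)
  rw [rcD_tup K ((len_removeNth _ _).trans_lt hx), Finset.smul_sum]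

theorem rcMap_tup (φ : X ⟶ Y) {n : ℕ} {x : Fin (n + 1) → X.carrier} (hx : len X x < ∞) :
    rcMap K φ n (tup K X x) = tup K Y fun i => φ.toFun (x i) := by
  by_cases h : IsRegular X x
  · rw [tup_of_regular K h, rcMap, Finsupp.linearCombination_single, one_smul]
  · rw [tup_of_not_regular K h, map_zero, tup_of_not_regular]
    intro h'
    exact h ((isRegular_iff x).2 ⟨fun i e => (h' i).1 (congrArg φ.toFun e), hx⟩)

theorem rcMap_comm (φ : X ⟶ Y) (n : ℕ) :
    rcD K Y n ∘ₗ rcMap K φ (n + 1) = rcMap K φ n ∘ₗ rcD K X n := by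
  refine Finsupp.lhom_ext' fun x => LinearMap.ext_ring ?_
  have hx : len X x.1 < ∞ := ((isRegular_iff x.1).1 x.2).2
  simp only [LinearMap.comp_apply, Finsupp.lsingle_apply]
  rw [← tup_of_regular K x.2, rcMap_tup K φ hx, rcD_tup K ((len_comp φ x.1).trans_lt hx),
    rcD_tup K hx, map_sum]
  refine Finset.sum_congr rfl fun i _ => ?_
  rw [map_smul, rcMap_tup K φ ((len_removeNth _ _).trans_lt hx)]
  rfl

theorem rcMap_id (n : ℕ) : rcMap K (𝟙 X) n = LinearMap.id := by
  refine Finsupp.lhom_ext' fun x => LinearMap.ext_ring ?_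
  simp only [LinearMap.comp_apply, Finsupp.lsingle_apply, LinearMap.id_apply]
  rw [← tup_of_regular K x.2, rcMap_tup K _ ((isRegular_iff x.1).1 x.2).2]
  rfl

theorem rcMap_comp {Z : QMet.{u}} (φ : X ⟶ Y) (ψ : Y ⟶ Z) (n : ℕ) :
    rcMap K (φ ≫ ψ) n = rcMap K ψ n ∘ₗ rcMap K φ n := by
  refine Finsupp.lhom_ext' fun x => LinearMap.ext_ring ?_
  have hx : len X x.1 < ∞ := ((isRegular_iff x.1).1 x.2).2
  simp only [LinearMap.comp_apply, Finsupp.lsingle_apply]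
  rw [← tup_of_regular K x.2, rcMap_tup K _ hx, rcMap_tup K _ hx,
    rcMap_tup K _ ((len_comp φ x.1).trans_lt hx)]
  rfl

variable (X) in
/-- The reachability complex `RC(X)`. -/
def rcCx : ChainComplex (ModuleCat.{max u v} K) ℕ :=
  ChainComplex.of (fun n => ModuleCat.of K (RTuple X n →₀ K)) (fun n => ModuleCat.ofHom (rcD K X n))
    fun n => ModuleCat.hom_ext (rcD_comp K n)

theorem rcCx_d (n : ℕ) : (rcCx K X).d (n + 1) n = ModuleCat.ofHom (rcD K X n) :=
  ChainComplex.of_d (fun n => ModuleCat.of K (RTuple X n →₀ K))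
    (fun n => ModuleCat.ofHom (rcD K X n)) n

/-- The chain map `RC(X) ⟶ RC(Y)` induced by a short map. -/
def rcCxMap (φ : X ⟶ Y) : rcCx K X ⟶ rcCx K Y :=
  ChainComplex.ofHom (fun n => ModuleCat.ofHom (rcMap K φ n)) fun n => by
    rw [rcCx_d, rcCx_d]
    exact ModuleCat.hom_ext (rcMap_comm K φ n)

/-- The span of the tuples in `RC_n(X)` that satisfy `P`. -/
def tupleSpan (P : ∀ n : ℕ, RTuple X n → Prop) (n : ℕ) : Submodule K ((rcCx K X).X n) :=
  Finsupp.supported K K {x : RTuple X n | P n x}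

theorem tup_mem_supported {n : ℕ} {P : RTuple X n → Prop} {x : Fin (n + 1) → X.carrier}
    (h : ∀ hx, P ⟨x, hx⟩) : tup K X x ∈ Finsupp.supported K K {y | P y} := by
  by_cases hx : IsRegular X x
  · rw [tup_of_regular K hx]
    exact Finsupp.single_mem_supported K _ (h hx)
  · rw [tup_of_not_regular K hx]
    exact zero_mem _

theorem supported_le_comap {n : ℕ} {P : RTuple X n → Prop} {M : Type*} [AddCommGroup M]
    [Module K M] {f : (RTuple X n →₀ K) →ₗ[K] M} {S : Submodule K M}
    (h : ∀ x, P x → f (tup K X x.1) ∈ S) : Finsupp.supported K K {y | P y} ≤ S.comap f := by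
  rw [Finsupp.supported_eq_span_single, Submodule.span_le]
  rintro _ ⟨x, hx, rfl⟩
  have h1 := h x hx
  rwa [tup_of_regular K x.2] at h1

theorem rcMap_tupleSpan (φ : X ⟶ Y) {P : ∀ n : ℕ, RTuple X n → Prop}
    {Q : ∀ n : ℕ, RTuple Y n → Prop}
    (h : ∀ n (x : RTuple X n), P n x → ∀ hy, Q n ⟨fun i => φ.toFun (x.1 i), hy⟩) (n : ℕ) :
    tupleSpan K P n ≤ (tupleSpan K Q n).comap ((rcCxMap K φ).f n).hom :=
  supported_le_comap (S := Finsupp.supported K K {y : RTuple Y n | Q n y})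
    (P := P n) (f := rcMap K φ n) K fun x hx => by
    rw [rcMap_tup K φ ((isRegular_iff x.1).1 x.2).2]
    exact tup_mem_supported K (h n x hx)

variable (X) in
/-- The subcomplex `F_r RC(X)`, spanned by the tuples with `L(x₀, …, xₙ) ≤ r`. -/
def rcF (r : ℝ) : Subcx (rcCx K X) where
  mod := tupleSpan K fun _ x => ((len X x.1 : ℝ≥0∞) : EReal) ≤ (r : EReal)
  d_mem i j := by
    by_cases hij : i = j + 1
    · subst hij
      rw [rcCx_d]
      refine supported_le_comap (f := rcD K X j)
        (P := fun x => ((len X x.1 : ℝ≥0∞) : EReal) ≤ (r : EReal)) K fun x hx => ?_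
      rw [rcD_tup K ((isRegular_iff x.1).1 x.2).2]
      refine Submodule.sum_mem _ fun k _ => Submodule.smul_mem _ _ (tup_mem_supported K fun _ => ?_)
      exact (EReal.coe_ennreal_le_coe_ennreal_iff.2 (len_removeNth x.1 k)).trans hx
    · intro x _
      rw [(rcCx K X).shape i j (fun h => hij h.symm)]
      refine Submodule.mem_comap.2 ?_
      rw [ModuleCat.hom_zero, LinearMap.zero_apply]
      exact zero_mem _

/-- The functor `X ↦ RC(X)` with values in `ℝ`-filtered complexes. -/
def RC : QMet.{u} ⥤ FiltCx.{v, max u v} K ℝ where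
  obj X :=
    { cx := rcCx K X
      F := rcF K X
      mono := fun h _ => Finsupp.supported_mono fun _ hx => le_trans hx (EReal.coe_le_coe_iff.2 h) }
  map φ :=
    { map := rcCxMap K φ
      mapsTo := fun _ => rcMap_tupleSpan K φ fun _ x hx _ =>
        (EReal.coe_ennreal_le_coe_ennreal_iff.2 (len_comp φ x.1)).trans hx }
  map_id _ := FiltCx.Hom.ext <| HomologicalComplex.hom_ext _ _ fun n =>
    congrArg ModuleCat.ofHom (rcMap_id K n)
  map_comp φ ψ := FiltCx.Hom.ext <| HomologicalComplex.hom_ext _ _ fun n =>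
    congrArg ModuleCat.ofHom (rcMap_comp K φ ψ n)

end RC

/-! ## The invariants -/

section Invariants

variable (K : Type v) [CommRing K]

/-- The `r`-spectral homology `SH^r_{n,I}(X)` of quasimetric spaces, for a non-empty interval
`I ⊆ ℝ`. -/
def SH (r : ℝ≥0) (n : ℕ) (I : Set ℝ) : QMet.{u} ⥤ ModuleCat.{max u v} K :=
  RC K ⋙ Prod.sectL _ (Ivl.pres I) ⋙ SHC.{v, max u v} K r n

/-- The persistent `r`-spectral homology `PSH^r_n(X)`: the persistent module
`ℓ ↦ SH^r_{n,(-∞,ℓ]}(X)`. -/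
def PSH (r : ℝ≥0) (n : ℕ) : QMet.{u} ⥤ ℝ ⥤ ModuleCat.{max u v} K :=
  RC K ⋙ Functor.curry.obj (SHC.{v, max u v} K r n) ⋙ (Functor.whiskeringLeft _ _ _).obj Ivl.iic

/-- The functor `C ↦ F_ℓ C / F_{(-∞,ℓ)} C`. -/
def stageQuot (ℓ : ℝ) : FiltCx.{v, w} K ℝ ⥤ ChainComplex (ModuleCat.{w} K) ℕ where
  obj C := (C.F ℓ).quot (C.FL (LowerSet.Iio ℓ))
  map f := Subcx.quotMap f.map (f.mapsTo ℓ) (FiltCx.FL_mapsTo f le_rfl)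
  map_id _ := Subcx.quotMap_id _ _
  map_comp f g := Subcx.quotMap_comp f.map g.map _ _ _ _ _ _

/-- Magnitude homology, `MH_{n,ℓ}(X) = H_n(F_ℓ RC(X) / F_{(-∞,ℓ)} RC(X))`. -/
def MH (n : ℕ) (ℓ : ℝ) : QMet.{u} ⥤ ModuleCat.{max u v} K :=
  RC K ⋙ stageQuot K ℓ ⋙ Hn.{v, max u v} K n

/-- Blurred magnitude homology, the persistent module `ℓ ↦ H_n(F_ℓ RC(X))`. -/
def BMH (n : ℕ) : QMet.{u} ⥤ ℝ ⥤ ModuleCat.{max u v} K :=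
  RC K ⋙ Functor.curry.obj (FiltCx.stage ⋙ Hn.{v, max u v} K n)

/-- The preorder on the points of `X` with `x ≤ y` if and only if `d(x, y) < ∞`. -/
@[reducible]
def reachPreorder (X : QMet.{u}) : Preorder X.carrier where
  le x y := X.dist x y < ∞
  le_refl x := by
    rw [(X.dist_eq_zero x x).2 rfl]
    exact ENNReal.zero_lt_top
  le_trans x y z h h' := (X.dist_triangle x y z).trans_lt (ENNReal.add_lt_top.2 ⟨h, h'⟩)

/-- The functor `X ↦ Pre(X)`. -/
def Pre : QMet.{u} ⥤ Preord.{u} where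
  obj X := @Preord.of X.carrier (reachPreorder X)
  map {X Y} φ :=
    letI := reachPreorder X
    letI := reachPreorder Y
    Preord.ofHom ⟨φ.toFun, fun x y h => (φ.short x y).trans_lt h⟩

/-- Reachability homology `RH_n(X) = H_n(Pre(X))`: the homology with coefficients in `K` of the
nerve of the preorder `Pre(X)`. -/
def RH (n : ℕ) : QMet.{u} ⥤ ModuleCat.{max u v} K :=
  Pre ⋙ preordToCat ⋙ nerveFunctor ⋙
    SSet.homologyFunctor (ModuleCat.of K (ULift.{u} K) : ModuleCat.{max u v} K) n

/-- The `ℤ`-filtered reachability complex of a digraph. -/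
def RCZ : Digr.{u} ⥤ FiltCx.{v, max u v} K ℤ :=
  Digr.toQMet ⋙ RC K ⋙ FiltCx.toInt

/-- The term `E^r_{ℓ,n-ℓ}(G)` of the `r`-th page of the magnitude-path spectral sequence. -/
def MPSS (r : ℕ) (hr : 1 ≤ r) (n : ℕ) (ℓ : ℤ) : Digr.{u} ⥤ ModuleCat.{max u v} K :=
  RCZ K ⋙ ssPage K r hr n ℓ

/-- The module `A_n(G)` spanned by the allowed paths `(g₀, …, gₙ)`: the tuples of vertices with
`gᵢ ≠ gᵢ₊₁` in which each `(gᵢ, gᵢ₊₁)` is an arrow. -/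
def allowed (G : Digr.{u}) (n : ℕ) : Submodule K ((rcCx K (Digr.toQMet.obj G)).X n) :=
  tupleSpan K (fun n (x : RTuple (Digr.toQMet.obj G) n) =>
    ∀ i : Fin n, G.arrow (x.1 i.castSucc) (x.1 i.succ)) n

/-- The complex of `∂`-invariant paths, `Ω_n(G) = {u ∈ A_n(G) : ∂u ∈ A_{n-1}(G)}`. Allowed paths and
their boundaries involve only tuples of vertices at finite consecutive distances, so that `∂` may
be computed in `RC(G)`. -/
def Omega : Digr.{u} ⥤ ChainComplex (ModuleCat.{max u v} K) ℕ where
  obj G := (Subcx.core (allowed K G)).cx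
  map {G H} f := Subcx.cxMap (rcCxMap K (Digr.toQMet.map f)) <| by
    have h : ∀ n, allowed K G n ≤
        (allowed K H n).comap ((rcCxMap K (Digr.toQMet.map f)).f n).hom :=
      rcMap_tupleSpan K _ fun n x hx _ i => f.map_arrow _ _ (hx i)
    intro n x hx
    obtain ⟨h1, h2⟩ := Submodule.mem_inf.1 hx
    refine Submodule.mem_inf.2 ⟨h n h1, (Submodule.mem_iInf _).2 fun m => ?_⟩
    have h3 := congrArg (fun k => k.hom x) ((rcCxMap K (Digr.toQMet.map f)).comm n m)
    have h4 := h m ((Submodule.mem_iInf _).1 h2 m)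
    exact (congrArg (· ∈ allowed K H m) h3).mpr h4
  map_id G := HomologicalComplex.hom_ext _ _ fun n =>
    ModuleCat.hom_ext <| LinearMap.ext fun x => Subtype.ext (DFunLike.congr_fun (rcMap_id K n) x.1)
  map_comp f g := HomologicalComplex.hom_ext _ _ fun n =>
    ModuleCat.hom_ext <| LinearMap.ext fun x => Subtype.ext (DFunLike.congr_fun
      (rcMap_comp K (Digr.toQMet.map f) (Digr.toQMet.map g) n) x.1)

/-- Path homology `PH_n(G) = H_n(Ω(G))`. -/
def PH (n : ℕ) : Digr.{u} ⥤ ModuleCat.{max u v} K :=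
  Omega K ⋙ Hn.{v, max u v} K n

end Invariants

end SpectralHomology

end

open SpectralHomology

/-!
Every functor in the theorem is a subquotient of a chain module of the reachability complex: its
value is `Z / (Z ∩ B)` for submodules `Z`, `B` of `RC_n(X)` that depend on the functor, and its maps
are induced by those of `RC`. For the homology of a quotient `S / T` of subcomplexes, `Z` consists
of the elements of `S_n` with boundary in `T` (`Subcx.relCycles`), and `B` of the elements that are
boundaries of elements of `S_{n+1}` modulo `T_n` (`Subcx.relBoundaries`). For
`SH^r_{n,I}` with `I = R \ L`, the numerator `Z` is that of `F_R / F_{L-r}` and the denominator `B`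
is that of `F_{R+r} / F_L`. This is recorded in the structure `Pres`, and two functors with the same
`Z` and the same `Z ∩ B` are isomorphic (`Pres.iso`). The comparisons with magnitude homology,
blurred magnitude homology, the pages of the magnitude-path spectral sequence and path homology thus
reduce to equalities of submodules:

* for `r = 0` the shifts do nothing;
* lengths of tuples in a digraph are integers, so that `F_{(-∞,m)} = F_{m-1}` for integers `m`,
  and the conditions for the page `r` become those for `SH^{r-1}`;
* in a digraph, a tuple of `n` steps has length at least `n`, with equality exactly for the allowed
  paths. Hence `(F_n)_n = A_n` and `F_{(-∞,n)}` vanishes in degree `n`, so that the numerator of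
  `SH¹_{n,{n}}` is the module of cycles of `Ω_n`, and its denominator meets it in `∂Ω_{n+1}`.

As the image of `H_n(C_{I_r})` in `H_n(C_I)` modulo the kernel of a map, `SH^r` is a subquotient of
`H_n(C_I)`, naturally in both `X` and `I` (`isSubquotient_imModKer`).

Homotopy invariance comes from the prism operator `prismMap`: if `d(φ x, ψ x) ≤ r` for all `x`, then
it is a chain homotopy from `φ` to `ψ` that raises lengths by at most `r` (`len_prism`). A
numerator of `SH^r_{n,I}` lies in `F_R` and has boundary in `F_{L-r}`, so that the prism operator
moves the two to `F_{R+r}` and `F_L`, which is what makes the difference of the images of `φ` and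
`ψ` an element of the denominator (`rcMap_sub_rcMap_mem`).

Over `I = ℝ` the shifts do nothing either, and `SH^r_{n,ℝ}` is the homology of the whole complex
`RC(X)`. A tuple with finite consecutive distances is a simplex of the nerve of the reachability
preorder, nondegenerate if and only if no two consecutive points agree; thus `RC(X)` is the complex
of normalized chains of this nerve (`rcNormalizedIso`), which computes its homology.
-/

noncomputable section

namespace SpectralHomology

/-! ### Functors presented as subquotients of a functor of modules -/

/-- A presentation of a functor `A` of `K`-modules as a subquotient of the functor `E`: naturally
in `j`, the module `A j` is the quotient of a submodule `Z j` of `E j` by `Z j ∩ B j`. The quotient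
map is recorded as a surjection `p`, so that `A` need not be literally a quotient. -/
structure Pres {K : Type v} [CommRing K] {J : Type*} [Category J] (E A : J ⥤ ModuleCat.{w} K) where
  Z : ∀ j, Submodule K (E.obj j)
  B : ∀ j, Submodule K (E.obj j)
  p : ∀ j, Z j →ₗ[K] A.obj j
  surj : ∀ j, Function.Surjective (p j)
  ker : ∀ j (z : Z j), p j z = 0 ↔ z.1 ∈ B j
  map_mem : ∀ {i j} (f : i ⟶ j) (z : Z i), (E.map f).hom z.1 ∈ Z j
  nat : ∀ {i j} (f : i ⟶ j) (z : Z i), (A.map f).hom (p i z) = p j ⟨(E.map f).hom z.1, map_mem f z⟩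

namespace Pres

variable {K : Type v} [CommRing K] {J : Type*} [Category J] {E A A' D : J ⥤ ModuleCat.{w} K}

/-- The presentation of a composite functor. -/
def precomp (P : Pres E A) {I : Type*} [Category I] (F : I ⥤ J) : Pres (F ⋙ E) (F ⋙ A) where
  Z i := P.Z (F.obj i)
  B i := P.B (F.obj i)
  p i := P.p (F.obj i)
  surj i := P.surj (F.obj i)
  ker i := P.ker (F.obj i)
  map_mem f := P.map_mem (F.map f)
  nat f := P.nat (F.map f)

theorem p_eq_iff (P : Pres E A) {j : J} (z z' : P.Z j) :
    P.p j z = P.p j z' ↔ z.1 - z'.1 ∈ P.B j := by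
  rw [← sub_eq_zero, ← map_sub, P.ker]
  rfl

theorem exists_linearMap (P : Pres E A) (P' : Pres E A') (hZ : ∀ j, P.Z j ≤ P'.Z j)
    (hB : ∀ j, P.Z j ⊓ P.B j ≤ P'.B j) (j : J) :
    ∃ g : A.obj j →ₗ[K] A'.obj j, ∀ z : P.Z j, g (P.p j z) = P'.p j ⟨z.1, hZ j z.2⟩ := by
  let e := (P.p j).quotKerEquivOfSurjective (P.surj j)
  let q : P.Z j →ₗ[K] A'.obj j := P'.p j ∘ₗ Submodule.inclusion (hZ j)
  refine ⟨(LinearMap.ker (P.p j)).liftQ q (fun z hz => ?_) ∘ₗ e.symm.toLinearMap, fun z => ?_⟩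
  · exact (P'.ker j _).2 (hB j ⟨z.2, (P.ker j z).1 hz⟩)
  · have h : e.symm (P.p j z) = Submodule.Quotient.mk z := by
      rw [LinearEquiv.symm_apply_eq]
      rfl
    rw [LinearMap.comp_apply, LinearEquiv.coe_coe, h]
    rfl

/-- The comparison of two subquotients of `E`, induced by an inclusion of the numerators. -/
def hom (P : Pres E A) (P' : Pres E A') (hZ : ∀ j, P.Z j ≤ P'.Z j)
    (hB : ∀ j, P.Z j ⊓ P.B j ≤ P'.B j) : A ⟶ A' where
  app j := ModuleCat.ofHom (P.exists_linearMap P' hZ hB j).choose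
  naturality i j f := by
    ext a
    obtain ⟨z, rfl⟩ := P.surj i a
    have hi := (P.exists_linearMap P' hZ hB i).choose_spec
    have hj := (P.exists_linearMap P' hZ hB j).choose_spec
    simp only [ModuleCat.hom_comp, ModuleCat.hom_ofHom, LinearMap.comp_apply]
    rw [P.nat f z, hi, hj, P'.nat f]

theorem hom_p (P : Pres E A) (P' : Pres E A') (hZ : ∀ j, P.Z j ≤ P'.Z j)
    (hB : ∀ j, P.Z j ⊓ P.B j ≤ P'.B j) (j : J) (z : P.Z j) :
    ((P.hom P' hZ hB).app j).hom (P.p j z) = P'.p j ⟨z.1, hZ j z.2⟩ :=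
  (P.exists_linearMap P' hZ hB j).choose_spec z

theorem hom_comp_hom (P : Pres E A) (P' : Pres E A') (hZ : ∀ j, P.Z j ≤ P'.Z j)
    (hB : ∀ j, P.Z j ⊓ P.B j ≤ P'.B j) (hZ' : ∀ j, P'.Z j ≤ P.Z j)
    (hB' : ∀ j, P'.Z j ⊓ P'.B j ≤ P.B j) : P.hom P' hZ hB ≫ P'.hom P hZ' hB' = 𝟙 A := by
  ext j a
  obtain ⟨z, rfl⟩ := P.surj j a
  rw [NatTrans.comp_app, ModuleCat.hom_comp, LinearMap.comp_apply, hom_p, hom_p]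
  rfl

/-- Two functors presented by the same numerators and denominators are isomorphic. -/
def iso (P : Pres E A) (P' : Pres E A') (hZ : ∀ j, P.Z j = P'.Z j)
    (hB : ∀ j, P.Z j ⊓ P.B j = P'.Z j ⊓ P'.B j) : A ≅ A' where
  hom := P.hom P' (fun j => (hZ j).le) fun j => (hB j).le.trans inf_le_right
  inv := P'.hom P (fun j => (hZ j).ge) fun j => (hB j).ge.trans inf_le_right
  hom_inv_id := hom_comp_hom _ _ _ _ _ _
  inv_hom_id := hom_comp_hom _ _ _ _ _ _

theorem mk_eq_zero_iff_of_ker {M N : Type*} [AddCommGroup M] [Module K M] [AddCommGroup N]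
    [Module K N] (S : Submodule K M) (g : M →ₗ[K] N) (x : S) :
    (Submodule.Quotient.mk x : SQ S (LinearMap.ker g)) = 0 ↔ g x.1 = 0 :=
  Submodule.Quotient.mk_eq_zero _

/-- The functor `Im f / Ker g` has the numerators of the source of `f` and the denominators of
the target of `g`. -/
def imModKer (PA : Pres E A) (PB : Pres E A') (PD : Pres E D) (f : A ⟶ A') (g : A' ⟶ D)
    (hA : ∀ j, PA.Z j ≤ PB.Z j) (hD : ∀ j, PB.Z j ≤ PD.Z j)
    (hf : ∀ j (z : PA.Z j), (f.app j).hom (PA.p j z) = PB.p j ⟨z.1, hA j z.2⟩)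
    (hg : ∀ j (z : PB.Z j), (g.app j).hom (PB.p j z) = PD.p j ⟨z.1, hD j z.2⟩) :
    Pres E (SpectralHomology.imModKer f g) where
  Z := PA.Z
  B := PD.B
  p j := (Submodule.mkQ ((LinearMap.ker (g.app j).hom).submoduleOf
    (LinearMap.range (f.app j).hom))) ∘ₗ (f.app j).hom.rangeRestrict ∘ₗ PA.p j
  surj j := (Submodule.mkQ_surjective _).comp
    ((LinearMap.surjective_rangeRestrict _).comp (PA.surj j))
  ker j z := by
    have h := mk_eq_zero_iff_of_ker _ (g.app j).hom ((f.app j).hom.rangeRestrict (PA.p j z))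
    have h2 : (g.app j).hom ((f.app j).hom (PA.p j z)) = PD.p j ⟨z.1, hD j (hA j z.2)⟩ := by
      rw [hf, hg]
    exact h.trans ((Eq.congr_left h2).trans (PD.ker j _))
  map_mem := PA.map_mem
  nat {i j} φ z := by
    have h : (A'.map φ).hom ((f.app i).hom (PA.p i z)) =
        (f.app j).hom (PA.p j ⟨(E.map φ).hom z.1, PA.map_mem φ z⟩) := by
      rw [hf, hf, PB.nat]
    exact congrArg (Submodule.mkQ ((LinearMap.ker (g.app j).hom).submoduleOf
      (LinearMap.range (f.app j).hom))) (Subtype.ext h)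

end Pres

/-! ### Subquotients -/

theorem IsSubquotient.of_iso {A : Type*} [Category A] {F F' G G' : A} (h : IsSubquotient F G)
    (e : F ≅ F') (e' : G ≅ G') : IsSubquotient F' G' := by
  obtain ⟨Z, i, p, _, _⟩ := h
  exact ⟨Z, i ≫ e'.hom, p ≫ e.hom, mono_comp _ _, epi_comp _ _⟩

theorem IsSubquotient.map_equivalence {A B : Type*} [Category A] [Category B] (T : A ≌ B) {F G : A}
    (h : IsSubquotient F G) : IsSubquotient (T.functor.obj F) (T.functor.obj G) := by
  obtain ⟨Z, i, p, _, _⟩ := h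
  exact ⟨_, T.functor.map i, T.functor.map p, inferInstance, inferInstance⟩

section

variable {K : Type v} [CommRing K] {J : Type*} [Category J] {A B D : J ⥤ ModuleCat.{w} K}

/-- The image of a natural transformation, as a functor of submodules of the target. -/
def rangeFunctor (f : A ⟶ B) : J ⥤ ModuleCat.{w} K where
  obj j := ModuleCat.of K (LinearMap.range (f.app j).hom)
  map {i j} φ := ModuleCat.ofHom ((B.map φ).hom.restrict (by
    rintro _ ⟨x, rfl⟩
    exact ⟨(A.map φ).hom x, congrArg (fun h => h.hom x) (f.naturality φ)⟩))
  map_id j := ModuleCat.hom_ext <| LinearMap.ext fun x =>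
    Subtype.ext (congrArg (fun h => h.hom x.1) (B.map_id j))
  map_comp φ ψ := ModuleCat.hom_ext <| LinearMap.ext fun x =>
    Subtype.ext (congrArg (fun h => h.hom x.1) (B.map_comp φ ψ))

theorem isSubquotient_imModKer (f : A ⟶ B) (g : B ⟶ D) : IsSubquotient (imModKer f g) B := by
  let i : rangeFunctor f ⟶ B :=
    { app := fun j => ModuleCat.ofHom (Submodule.subtype _), naturality := fun _ _ _ => rfl }
  let p : rangeFunctor f ⟶ imModKer f g :=
    { app := fun j => ModuleCat.ofHom (Submodule.mkQ _), naturality := fun _ _ _ => rfl }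
  have hi : ∀ j, Mono (i.app j) := fun j =>
    (ModuleCat.mono_iff_injective _).2 Subtype.val_injective
  have hp : ∀ j, Epi (p.app j) := fun j =>
    (ModuleCat.epi_iff_surjective _).2 (Submodule.mkQ_surjective _)
  exact ⟨rangeFunctor f, i, p, NatTrans.mono_of_mono_app i, NatTrans.epi_of_epi_app p⟩

end

/-! ### Homology classes represented by cycles -/

section Cycles

variable {K : Type v} [CommRing K]

/-- The cycles of degree `n`. The condition ranges over all the differentials out of degree `n`,
only one of which can be nonzero; this treats degree `0` on the same footing. -/
def cyc (G : ChainComplex (ModuleCat.{w} K) ℕ) (n : ℕ) : Submodule K (G.X n) :=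
  ⨅ m : ℕ, LinearMap.ker (G.d n m).hom

theorem mem_cyc {G : ChainComplex (ModuleCat.{w} K) ℕ} {n : ℕ} {x : G.X n} :
    x ∈ cyc G n ↔ ∀ m, (G.d n m).hom x = 0 := by
  simp [cyc, Submodule.mem_iInf]

theorem cyc_subtype_comp_d (G : ChainComplex (ModuleCat.{w} K) ℕ) (n m : ℕ) :
    ModuleCat.ofHom (cyc G n).subtype ≫ G.d n m = 0 :=
  ModuleCat.hom_ext <| LinearMap.ext fun x => mem_cyc.1 x.2 m

/-- The homology class of a cycle. -/
def toHomology (G : ChainComplex (ModuleCat.{w} K) ℕ) (n : ℕ) : cyc G n →ₗ[K] G.homology n :=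
  (G.liftCycles (ModuleCat.ofHom (cyc G n).subtype) _ rfl (cyc_subtype_comp_d G n _) ≫
    G.homologyπ n).hom

theorem toHomology_surjective (G : ChainComplex (ModuleCat.{w} K) ℕ) (n : ℕ) :
    Function.Surjective (toHomology G n) := by
  intro a
  obtain ⟨c, rfl⟩ := (ModuleCat.epi_iff_surjective (G.homologyπ n)).1 inferInstance a
  have hc : (G.iCycles n).hom c ∈ cyc G n := mem_cyc.2 fun m =>
    congrArg (fun h => h.hom c) (G.iCycles_d n m)
  refine ⟨⟨_, hc⟩, congrArg (G.homologyπ n).hom ?_⟩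
  refine (ModuleCat.mono_iff_injective (G.iCycles n)).1 inferInstance ?_
  exact congrArg (fun h => h.hom (⟨_, hc⟩ : cyc G n))
    (G.liftCycles_i _ _ rfl (cyc_subtype_comp_d G n _))

theorem toHomology_eq_zero_iff (G : ChainComplex (ModuleCat.{w} K) ℕ) (n : ℕ) (x : cyc G n) :
    toHomology G n x = 0 ↔ ∃ y, (G.d (n + 1) n).hom y = x.1 := by
  have hex := ShortComplex.exact_of_g_is_cokernel
    (ShortComplex.mk _ _ (G.toCycles_comp_homologyπ (n + 1) n))
    (G.homologyIsCokernel (n + 1) n (ChainComplex.prev ℕ n))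
  rw [ShortComplex.moduleCat_exact_iff] at hex
  have hi : Function.Injective (G.iCycles n).hom :=
    (ModuleCat.mono_iff_injective (G.iCycles n)).1 inferInstance
  have hl := congrArg (fun h => h.hom x) (G.liftCycles_i _ _ rfl (cyc_subtype_comp_d G n _))
  constructor
  · intro h
    obtain ⟨y, hy⟩ := hex _ h
    refine ⟨y, ?_⟩
    rw [← G.toCycles_i (n + 1) n]
    exact (congrArg (G.iCycles n).hom hy).trans hl
  · rintro ⟨y, hy⟩
    have h : (G.toCycles (n + 1) n).hom y =
        (G.liftCycles (ModuleCat.ofHom (cyc G n).subtype) _ rfl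
          (cyc_subtype_comp_d G n _)).hom x := by
      refine hi (Eq.trans ?_ hl.symm)
      exact (congrArg (fun h => h.hom y) (G.toCycles_i (n + 1) n)).trans hy
    refine (congrArg (G.homologyπ n).hom h.symm).trans ?_
    exact congrArg (fun h => h.hom y) (G.toCycles_comp_homologyπ (n + 1) n)

theorem map_mem_cyc {G H : ChainComplex (ModuleCat.{w} K) ℕ} (f : G ⟶ H) {n : ℕ} {x : G.X n}
    (hx : x ∈ cyc G n) : (f.f n).hom x ∈ cyc H n := mem_cyc.2 fun m => by
  refine (congrArg (fun h => h.hom x) (f.comm n m)).trans ?_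
  exact (congrArg (f.f m).hom (mem_cyc.1 hx m)).trans (map_zero _)

theorem homologyMap_toHomology {G H : ChainComplex (ModuleCat.{w} K) ℕ} (f : G ⟶ H) (n : ℕ)
    (x : cyc G n) : (HomologicalComplex.homologyMap f n).hom (toHomology G n x) =
      toHomology H n ⟨(f.f n).hom x.1, map_mem_cyc f x.2⟩ := by
  refine (congrArg (fun h => h.hom ((G.liftCycles _ _ rfl (cyc_subtype_comp_d G n _)).hom x))
    (HomologicalComplex.homologyπ_naturality f n)).trans ?_
  refine congrArg (H.homologyπ n).hom ?_
  refine (ModuleCat.mono_iff_injective (H.iCycles n)).1 inferInstance ?_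
  have h1 := congrArg (fun h => h.hom ((G.liftCycles _ _ rfl (cyc_subtype_comp_d G n _)).hom x))
    (HomologicalComplex.cyclesMap_i f n)
  have h2 := congrArg (fun h => h.hom x) (G.liftCycles_i _ _ rfl (cyc_subtype_comp_d G n _))
  have h3 := congrArg (fun h => h.hom (⟨(f.f n).hom x.1, map_mem_cyc f x.2⟩ : cyc H n))
    (H.liftCycles_i _ _ rfl (cyc_subtype_comp_d H n _))
  exact h1.trans ((congrArg (f.f n).hom h2).trans h3.symm)

end Cycles

/-! ### Presentations of functors of chain complexes -/

/-- The cycles of degree `n` of `S` relative to `T`: the `z ∈ S` with `∂z ∈ T`. -/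
def Subcx.relCycles {K : Type v} [CommRing K] {C : ChainComplex (ModuleCat.{w} K) ℕ}
    (S T : Subcx C) (n : ℕ) : Submodule K (C.X n) :=
  S.mod n ⊓ ⨅ m : ℕ, (T.mod m).comap (C.d n m).hom

/-- The boundaries of degree `n` of `S` modulo `T`, that is `∂S + T`. -/
def Subcx.relBoundaries {K : Type v} [CommRing K] {C : ChainComplex (ModuleCat.{w} K) ℕ}
    (S T : Subcx C) (n : ℕ) : Submodule K (C.X n) :=
  (S.mod (n + 1)).map (C.d (n + 1) n).hom ⊔ T.mod n

theorem Subcx.mem_relCycles {K : Type v} [CommRing K] {C : ChainComplex (ModuleCat.{w} K) ℕ}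
    {S T : Subcx C} {n : ℕ} {x : C.X n} :
    x ∈ S.relCycles T n ↔ x ∈ S.mod n ∧ ∀ m, (C.d n m).hom x ∈ T.mod m := by
  simp [relCycles, Submodule.mem_iInf]

theorem Subcx.mem_relBoundaries {K : Type v} [CommRing K] {C : ChainComplex (ModuleCat.{w} K) ℕ}
    {S T : Subcx C} {n : ℕ} {x : C.X n} :
    x ∈ S.relBoundaries T n ↔ ∃ y ∈ S.mod (n + 1), x - (C.d (n + 1) n).hom y ∈ T.mod n := by
  simp only [relBoundaries, Submodule.mem_sup, Submodule.mem_map]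
  constructor
  · rintro ⟨_, ⟨y, hy, rfl⟩, t, ht, rfl⟩
    exact ⟨y, hy, by rwa [add_sub_cancel_left]⟩
  · rintro ⟨y, hy, h⟩
    exact ⟨_, ⟨y, hy, rfl⟩, _, h, add_sub_cancel _ _⟩

/-- A presentation of a functor `G` of chain complexes as a subquotient `S / (S ∩ T)` of the
functor `E`, for subcomplexes `S` and `T`. -/
structure CxPres {K : Type v} [CommRing K] {J : Type*} [Category J]
    (E G : J ⥤ ChainComplex (ModuleCat.{w} K) ℕ) where
  S : ∀ j, Subcx (E.obj j)
  T : ∀ j, Subcx (E.obj j)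
  p : ∀ j m, (S j).mod m →ₗ[K] (G.obj j).X m
  surj : ∀ j m, Function.Surjective (p j m)
  ker : ∀ j m (x : (S j).mod m), p j m x = 0 ↔ x.1 ∈ (T j).mod m
  d_p : ∀ j a b (x : (S j).mod a),
    ((G.obj j).d a b).hom (p j a x) = p j b ⟨((E.obj j).d a b).hom x.1, (S j).d_mem a b x.2⟩
  map_mem : ∀ {i j} (f : i ⟶ j), Subcx.MapsTo (E.map f) (S i) (S j)
  nat : ∀ {i j} (f : i ⟶ j) m (x : (S i).mod m),
    ((G.map f).f m).hom (p i m x) = p j m ⟨((E.map f).f m).hom x.1, map_mem f m x.2⟩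

namespace CxPres

variable {K : Type v} [CommRing K] {J : Type*} [Category J]
variable {E G : J ⥤ ChainComplex (ModuleCat.{w} K) ℕ}

theorem map_mem_T (P : CxPres E G) {i j : J} (f : i ⟶ j) {m : ℕ} {x : (E.obj i).X m}
    (hS : x ∈ (P.S i).mod m) (hT : x ∈ (P.T i).mod m) :
    ((E.map f).f m).hom x ∈ (P.T j).mod m := by
  rw [← P.ker j m ⟨_, P.map_mem f m hS⟩, ← P.nat f m ⟨x, hS⟩, (P.ker i m ⟨x, hS⟩).2 hT, map_zero]

/-- The homology class of a relative cycle. -/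
def toHomology (P : CxPres E G) (n : ℕ) (j : J) :
    (P.S j).relCycles (P.T j) n →ₗ[K] (G.obj j).homology n :=
  SpectralHomology.toHomology (G.obj j) n ∘ₗ LinearMap.codRestrict (cyc (G.obj j) n)
    (P.p j n ∘ₗ Submodule.inclusion inf_le_left) fun z => mem_cyc.2 fun m => by
      rw [LinearMap.comp_apply, P.d_p, P.ker]
      exact (Subcx.mem_relCycles.1 z.2).2 m

theorem toHomology_surjective (P : CxPres E G) (n : ℕ) (j : J) :
    Function.Surjective (P.toHomology n j) := by
  intro a
  obtain ⟨c, rfl⟩ := SpectralHomology.toHomology_surjective _ _ a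
  obtain ⟨s, hs⟩ := P.surj j n c.1
  refine ⟨⟨s.1, Subcx.mem_relCycles.2 ⟨s.2, fun m => ?_⟩⟩, ?_⟩
  · rw [← P.ker j m ⟨_, (P.S j).d_mem n m s.2⟩, ← P.d_p, hs]
    exact mem_cyc.1 c.2 m
  · exact congrArg (SpectralHomology.toHomology (G.obj j) n) (Subtype.ext hs)

theorem toHomology_eq_zero_iff (P : CxPres E G) (n : ℕ) (j : J)
    (z : (P.S j).relCycles (P.T j) n) :
    P.toHomology n j z = 0 ↔ z.1 ∈ (P.S j).relBoundaries (P.T j) n := by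
  have key : ∀ s : (P.S j).mod (n + 1), ((G.obj j).d (n + 1) n).hom (P.p j (n + 1) s) =
      P.p j n ⟨z.1, z.2.1⟩ ↔ z.1 - ((E.obj j).d (n + 1) n).hom s.1 ∈ (P.T j).mod n := by
    intro s
    rw [P.d_p, eq_comm, ← sub_eq_zero, ← map_sub, P.ker]
    rfl
  rw [toHomology, LinearMap.comp_apply, SpectralHomology.toHomology_eq_zero_iff,
    Subcx.mem_relBoundaries]
  constructor
  · rintro ⟨y, hy⟩
    obtain ⟨s, rfl⟩ := P.surj j (n + 1) y
    exact ⟨s.1, s.2, (key s).1 hy⟩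
  · rintro ⟨s, hs, h⟩
    exact ⟨_, (key ⟨s, hs⟩).2 h⟩

theorem map_mem_relCycles (P : CxPres E G) (n : ℕ) {i j : J} (f : i ⟶ j)
    (z : (P.S i).relCycles (P.T i) n) :
    ((E.map f).f n).hom z.1 ∈ (P.S j).relCycles (P.T j) n := by
  obtain ⟨h1, h2⟩ := Subcx.mem_relCycles.1 z.2
  refine Subcx.mem_relCycles.2 ⟨P.map_mem f n h1, fun m => ?_⟩
  have h := P.map_mem_T f ((P.S i).d_mem n m h1) (h2 m)
  have h' := congrArg (fun k => k.hom z.1) ((E.map f).comm n m)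
  exact (congrArg (· ∈ (P.T j).mod m) h').mpr h

theorem map_toHomology (P : CxPres E G) (n : ℕ) {i j : J} (f : i ⟶ j)
    (z : (P.S i).relCycles (P.T i) n) :
    (HomologicalComplex.homologyMap (G.map f) n).hom (P.toHomology n i z) =
      P.toHomology n j ⟨((E.map f).f n).hom z.1, P.map_mem_relCycles n f z⟩ :=
  (homologyMap_toHomology (G.map f) n _).trans
    (congrArg (SpectralHomology.toHomology (G.obj j) n) (Subtype.ext (P.nat f n ⟨z.1, z.2.1⟩)))

/-- The homology of `S / T` is the quotient of the relative cycles `{z ∈ S : ∂z ∈ T}` by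
`∂S + T`. -/
def homology (P : CxPres E G) (n : ℕ) :
    Pres (E ⋙ HomologicalComplex.eval _ _ n) (G ⋙ Hn K n) where
  Z j := (P.S j).relCycles (P.T j) n
  B j := (P.S j).relBoundaries (P.T j) n
  p j := P.toHomology n j
  surj j := P.toHomology_surjective n j
  ker j z := P.toHomology_eq_zero_iff n j z
  map_mem f z := P.map_mem_relCycles n f z
  nat f z := P.map_toHomology n f z

end CxPres

/-! ### Presentations of the homology of filtered complexes -/

section Filtered

variable {K : Type v} [CommRing K]

variable (K) in
/-- The underlying complex, forgetting the filtration. -/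
def FiltCx.forget (ι : Type) [Preorder ι] :
    FiltCx.{v, w} K ι ⥤ ChainComplex (ModuleCat.{w} K) ℕ where
  obj C := C.cx
  map f := f.map

/-- The zero subcomplex. -/
def Subcx.bot (C : ChainComplex (ModuleCat.{w} K) ℕ) : Subcx C where
  mod _ := ⊥
  d_mem _ _ := bot_le

theorem mk_eq_zero_iff_mem {M : Type*} [AddCommGroup M] [Module K M] (S T : Submodule K M) (x : S) :
    Submodule.mkQ (T.submoduleOf S) x = 0 ↔ x.1 ∈ T :=
  Submodule.Quotient.mk_eq_zero _

theorem surjective_mkQ_submoduleOf {M : Type*} [AddCommGroup M] [Module K M]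
    (S T : Submodule K M) : Function.Surjective (Submodule.mkQ (T.submoduleOf S)) :=
  Submodule.mkQ_surjective _

/-- `F_a C / F_b C` as a subquotient of `C`. -/
def cxPresGr {ι : Type} [Preorder ι] (a b : ι) :
    CxPres (FiltCx.forget.{v, w} K ι) (FiltCx.gr a b) where
  S C := C.F a
  T C := C.F b
  p C m := Submodule.mkQ (((C.F b).mod m).submoduleOf ((C.F a).mod m))
  surj _ _ := surjective_mkQ_submoduleOf _ _
  ker _ _ x := mk_eq_zero_iff_mem _ _ x
  d_p _ _ _ _ := rfl
  map_mem f := f.mapsTo a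
  nat _ _ _ := rfl

/-- `C_{T I}` as a subquotient of `C`, for a functor `T` on intervals. -/
def cxPresIvl (T : Ivl ⥤ Ivl) :
    CxPres (CategoryTheory.Prod.fst (FiltCx.{v, w} K ℝ) Ivl ⋙ FiltCx.forget.{v, w} K ℝ)
      ((𝟭 (FiltCx.{v, w} K ℝ)).prod T ⋙ cxIvl.{v, w} K) where
  S p := p.1.FL (T.obj p.2).R
  T p := p.1.FL (T.obj p.2).L
  p p m := Submodule.mkQ
    (((p.1.FL (T.obj p.2).L).mod m).submoduleOf ((p.1.FL (T.obj p.2).R).mod m))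
  surj _ _ := surjective_mkQ_submoduleOf _ _
  ker _ _ x := mk_eq_zero_iff_mem _ _ x
  d_p _ _ _ _ := rfl
  map_mem f := FiltCx.FL_mapsTo f.1 (leOfHom (T.map f.2)).1
  nat _ _ _ := rfl

/-- `F_ℓ C / F_{(-∞,ℓ)} C` as a subquotient of `C`. -/
def cxPresStageQuot (ℓ : ℝ) : CxPres (FiltCx.forget.{v, w} K ℝ) (stageQuot K ℓ) where
  S C := C.F ℓ
  T C := C.FL (LowerSet.Iio ℓ)
  p C m := Submodule.mkQ (((C.FL (LowerSet.Iio ℓ)).mod m).submoduleOf ((C.F ℓ).mod m))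
  surj _ _ := surjective_mkQ_submoduleOf _ _
  ker _ _ x := mk_eq_zero_iff_mem _ _ x
  d_p _ _ _ _ := rfl
  map_mem f := f.mapsTo ℓ
  nat _ _ _ := rfl

/-- `F_ℓ C` as a subquotient of `C`, for variable `ℓ`. -/
def cxPresStage {ι : Type} [Preorder ι] :
    CxPres (CategoryTheory.Prod.fst (FiltCx.{v, w} K ι) ι ⋙ FiltCx.forget.{v, w} K ι)
      FiltCx.stage where
  S p := p.1.F p.2
  T p := Subcx.bot p.1.cx
  p _ _ := LinearMap.id
  surj _ _ := Function.surjective_id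
  ker _ _ _ := Subtype.ext_iff
  d_p _ _ _ _ := rfl
  map_mem {p q} f n _ hx := q.1.mono (leOfHom f.2) n (f.1.mapsTo p.2 n hx)
  nat _ _ _ := rfl

/-- The trivial presentation of a functor of chain complexes. -/
def cxPresSelf {J : Type*} [Category J] (E : J ⥤ ChainComplex (ModuleCat.{w} K) ℕ) :
    CxPres E E where
  S _ := ⟨fun _ => ⊤, fun _ _ => le_top⟩
  T _ := Subcx.bot _
  p _ _ := (Submodule.topEquiv (R := K)).toLinearMap
  surj _ _ := (Submodule.topEquiv (R := K)).surjective
  ker _ _ _ := Iff.rfl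
  d_p _ _ _ _ := rfl
  map_mem _ _ _ _ := trivial
  nat _ _ _ := rfl

/-- `Ω(G)` as a subcomplex of `RC(G)`. -/
def cxPresOmega : CxPres (Digr.toQMet ⋙ RC.{u, v} K ⋙ FiltCx.forget K ℝ) (Omega K) where
  S G := Subcx.core (allowed K G)
  T _ := Subcx.bot _
  p _ _ := LinearMap.id
  surj _ _ := Function.surjective_id
  ker _ _ _ := Subtype.ext_iff
  d_p _ _ _ _ := rfl
  map_mem f n x hx := (((Omega K).map f).f n).hom ⟨x, hx⟩ |>.2
  nat _ _ _ := rfl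

/-- The presentation of the homology of `C_{T I}`, for a functor `T` on intervals. It is that of
`cxPresIvl`, with the composite functors bracketed as in the definition of `SHC`. -/
def presHnIvl (T : Ivl ⥤ Ivl) (n : ℕ) :
    Pres ((CategoryTheory.Prod.fst (FiltCx.{v, w} K ℝ) Ivl ⋙ FiltCx.forget.{v, w} K ℝ) ⋙
      HomologicalComplex.eval _ _ n)
      ((𝟭 (FiltCx.{v, w} K ℝ)).prod T ⋙ cxIvl.{v, w} K ⋙ Hn.{v, w} K n) where
  Z := ((cxPresIvl.{v, w} T).homology n).Z
  B := ((cxPresIvl.{v, w} T).homology n).B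
  p := ((cxPresIvl.{v, w} T).homology n).p
  surj := ((cxPresIvl.{v, w} T).homology n).surj
  ker := ((cxPresIvl.{v, w} T).homology n).ker
  map_mem := ((cxPresIvl.{v, w} T).homology n).map_mem
  nat := ((cxPresIvl.{v, w} T).homology n).nat

/-- The presentation of the homology of `C_I`; the identity functor is the middle term in the
definition of `SHC`. -/
def presHnIvlSelf (n : ℕ) :
    Pres ((CategoryTheory.Prod.fst (FiltCx.{v, w} K ℝ) Ivl ⋙ FiltCx.forget.{v, w} K ℝ) ⋙
      HomologicalComplex.eval _ _ n)
      (𝟭 (FiltCx.{v, w} K ℝ × Ivl) ⋙ cxIvl.{v, w} K ⋙ Hn.{v, w} K n) where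
  Z := (presHnIvl.{v, w} (𝟭 _) n).Z
  B := (presHnIvl.{v, w} (𝟭 _) n).B
  p := (presHnIvl.{v, w} (𝟭 _) n).p
  surj := (presHnIvl.{v, w} (𝟭 _) n).surj
  ker := (presHnIvl.{v, w} (𝟭 _) n).ker
  map_mem := (presHnIvl.{v, w} (𝟭 _) n).map_mem
  nat := (presHnIvl.{v, w} (𝟭 _) n).nat

/-- The presentation of `SH^r_{n,I}(C)` by the numerators `{z ∈ F_R : ∂z ∈ F_{L-r}}` and the
denominators `∂F_{R+r} + F_L`. -/
def presSHC (r : ℝ≥0) (n : ℕ) :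
    Pres ((CategoryTheory.Prod.fst (FiltCx.{v, w} K ℝ) Ivl ⋙ FiltCx.forget.{v, w} K ℝ) ⋙
      HomologicalComplex.eval _ _ n) (SHC.{v, w} K r n) :=
  Pres.imModKer (presHnIvl.{v, w} (Ivl.lo r) n) (presHnIvlSelf.{v, w} n)
    (presHnIvl.{v, w} (Ivl.hi r) n)
    (Functor.whiskerRight (loHom.{v, w} K r) (cxIvl.{v, w} K ⋙ Hn.{v, w} K n))
    (Functor.whiskerRight (hiHom.{v, w} K r) (cxIvl.{v, w} K ⋙ Hn.{v, w} K n))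
    (fun p x hx => by
      obtain ⟨h1, h2⟩ := Subcx.mem_relCycles.1 hx
      exact Subcx.mem_relCycles.2 ⟨h1, fun m =>
        FiltCx.FL_mapsTo (𝟙 p.1) (Ivl.shift_neg_le p.2.L r) m (h2 m)⟩)
    (fun p x hx => by
      obtain ⟨h1, h2⟩ := Subcx.mem_relCycles.1 hx
      exact Subcx.mem_relCycles.2 ⟨FiltCx.FL_mapsTo (𝟙 p.1) (Ivl.le_shift p.2.R r) n h1, h2⟩)
    (fun p z => by
      refine (homologyMap_toHomology ((cxIvl.{v, w} K).map ((loHom.{v, w} K r).app p)) n _).trans ?_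
      rfl)
    (fun p z => by
      refine (homologyMap_toHomology ((cxIvl.{v, w} K).map ((hiHom.{v, w} K r).app p)) n _).trans ?_
      rfl)

/-- The presentation of `E^r_{ℓ,n-ℓ}(C)` by the numerators `{z ∈ F_ℓ : ∂z ∈ F_{ℓ-r}}` and the
denominators `∂F_{ℓ+r-1} + F_{ℓ-1}`. -/
def presSSPage (r : ℕ) (hr : 1 ≤ r) (n : ℕ) (ℓ : ℤ) :
    Pres (FiltCx.forget.{v, w} K ℤ ⋙ HomologicalComplex.eval _ _ n) (ssPage K r hr n ℓ) :=
  Pres.imModKer ((cxPresGr ℓ (ℓ - r)).homology n) ((cxPresGr ℓ (ℓ - 1)).homology n)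
    ((cxPresGr (ℓ + r - 1) (ℓ - 1)).homology n) _ _
    (fun C x hx => by
      obtain ⟨h1, h2⟩ := Subcx.mem_relCycles.1 hx
      exact Subcx.mem_relCycles.2 ⟨h1, fun m => C.mono (by lia) m (h2 m)⟩)
    (fun C x hx => by
      obtain ⟨h1, h2⟩ := Subcx.mem_relCycles.1 hx
      exact Subcx.mem_relCycles.2 ⟨C.mono (by lia) n h1, h2⟩)
    (fun C z => by
      refine (homologyMap_toHomology ((FiltCx.grMap _ _).app C) n _).trans ?_
      rfl)
    (fun C z => by
      refine (homologyMap_toHomology ((FiltCx.grMap _ _).app C) n _).trans ?_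
      rfl)

end Filtered

/-! ### Left infinite intervals -/

namespace Ivl

theorem pres_singleton (ℓ : ℝ) : pres {ℓ} = ⟨LowerSet.Iic ℓ, LowerSet.Iio ℓ⟩ := by
  refine congrArg₂ Ivl.mk (LowerSet.ext (Set.ext fun x => ?_)) (LowerSet.ext (Set.ext fun x => ?_))
  · exact ⟨fun ⟨i, hi, h⟩ => h.trans_eq hi, fun h => ⟨ℓ, rfl, h⟩⟩
  · exact ⟨fun h => h ℓ rfl, fun h i hi => lt_of_lt_of_eq h hi.symm⟩

theorem pres_Iic (ℓ : ℝ) : pres (Set.Iic ℓ) = ⟨LowerSet.Iic ℓ, ⊥⟩ := by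
  refine congrArg₂ Ivl.mk (LowerSet.ext (Set.ext fun x => ?_)) (LowerSet.ext (Set.ext fun x => ?_))
  · exact ⟨fun ⟨i, hi, h⟩ => h.trans hi, fun h => ⟨ℓ, le_refl ℓ, h⟩⟩
  · exact ⟨fun h => (lt_irrefl _ ((h (min x ℓ) (min_le_right x ℓ)).trans_le
      (min_le_left x ℓ))).elim, fun h => h.elim⟩

theorem pres_univ : pres Set.univ = ⟨⊤, ⊥⟩ := by
  refine congrArg₂ Ivl.mk (LowerSet.ext (Set.ext fun x => ?_)) (LowerSet.ext (Set.ext fun x => ?_))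
  · exact ⟨fun _ => trivial, fun _ => ⟨x, trivial, le_rfl⟩⟩
  · exact ⟨fun h => lt_irrefl x (h x trivial), fun h => h.elim⟩

theorem shift_zero (L : LowerSet ℝ) : shift L 0 = L :=
  LowerSet.ext (Set.ext fun x => by simp [shift])

theorem shift_neg_shift (L : LowerSet ℝ) (t : ℝ) : shift (shift L (-t)) t = L :=
  LowerSet.ext (Set.ext fun x => by simp [shift])

theorem shift_bot (t : ℝ) : shift ⊥ t = ⊥ :=
  LowerSet.ext (Set.ext fun x => by simp [shift])

theorem shift_top (t : ℝ) : shift ⊤ t = ⊤ :=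
  LowerSet.ext (Set.ext fun x => by simp [shift])

theorem shift_Iic (a t : ℝ) : shift (LowerSet.Iic a) t = LowerSet.Iic (a + t) :=
  LowerSet.ext (Set.ext fun x => by simp [shift])

theorem shift_Iio (a t : ℝ) : shift (LowerSet.Iio a) t = LowerSet.Iio (a + t) :=
  LowerSet.ext (Set.ext fun x => by simp [shift, sub_lt_iff_lt_add])

end Ivl

theorem Subcx.ext_mod {K : Type v} [CommRing K] {C : ChainComplex (ModuleCat.{w} K) ℕ}
    {S T : Subcx C} (h : ∀ n, S.mod n = T.mod n) : S = T := by
  cases S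
  cases T
  congr
  exact funext h

namespace FiltCx

variable {K : Type v} [CommRing K] (C : FiltCx.{v, w} K ℝ)

theorem FL_Iic (a : ℝ) : C.FL (LowerSet.Iic a) = C.F a :=
  Subcx.ext_mod fun n => le_antisymm (iSup_le fun b => C.mono b.2 n)
    (le_iSup (fun b : LowerSet.Iic a => (C.F b.1).mod n) ⟨a, le_refl a⟩)

theorem FL_bot : C.FL ⊥ = Subcx.bot C.cx :=
  Subcx.ext_mod fun _ => le_antisymm (iSup_le fun b => b.2.elim) bot_le

end FiltCx

section

variable (K : Type v) [CommRing K]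

theorem coe_len_le_iff {X : QMet.{u}} {n : ℕ} (x : RTuple X n) (a : ℝ) :
    ((len X x.1 : ℝ≥0∞) : EReal) ≤ (a : EReal) ↔ (len X x.1).toReal ≤ a := by
  rw [← EReal.coe_ennreal_toReal ((isRegular_iff x.1).1 x.2).2.ne, EReal.coe_le_coe_iff]

theorem rcF_mod (X : QMet.{u}) (a : ℝ) (n : ℕ) :
    (rcF K X a).mod n = tupleSpan K (fun _ x => (len X x.1).toReal ≤ a) n :=
  congrArg (Finsupp.supported K K) (Set.ext fun x => coe_len_le_iff x a)

/-- `F_L RC(X)` is spanned by the tuples whose length belongs to `L`. -/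
theorem FL_RC_mod (X : QMet.{u}) (L : LowerSet ℝ) (n : ℕ) :
    (((RC.{u, v} K).obj X).FL L).mod n = tupleSpan K (fun _ x => (len X x.1).toReal ∈ L) n := by
  refine (Finsupp.supported_iUnion (M := K) (R := K) (fun a : L =>
    {x : RTuple X n | ((len X x.1 : ℝ≥0∞) : EReal) ≤ (a.1 : EReal)})).symm.trans ?_
  refine congrArg (Finsupp.supported K K) (Set.ext fun x => ?_)
  simp only [Set.mem_iUnion, Set.mem_ofPred_eq, coe_len_le_iff]
  exact ⟨fun ⟨a, h⟩ => L.lower h a.2, fun h => ⟨⟨_, h⟩, le_rfl⟩⟩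

theorem FL_RC_congr (X : QMet.{u}) {L L' : LowerSet ℝ}
    (h : ∀ n (x : RTuple X n), (len X x.1).toReal ∈ L ↔ (len X x.1).toReal ∈ L') :
    ((RC.{u, v} K).obj X).FL L = ((RC.{u, v} K).obj X).FL L' :=
  Subcx.ext_mod fun n => by
    rw [FL_RC_mod, FL_RC_mod]
    exact congrArg (Finsupp.supported K K) (Set.ext fun x => h n x)

/-! ### Magnitude homology and blurred magnitude homology -/

/-- The presentation of `SH^r_{n,I}(X)` as a subquotient of `RC_n(X)`. -/
def presSH (r : ℝ≥0) (n : ℕ) (I : Set ℝ) :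
    Pres (RC.{u, v} K ⋙ FiltCx.forget K ℝ ⋙ HomologicalComplex.eval _ _ n) (SH K r n I) :=
  (presSHC r n).precomp (RC.{u, v} K ⋙ Prod.sectL _ (Ivl.pres I))

theorem presSH_Z (r : ℝ≥0) (n : ℕ) (I : Set ℝ) (X : QMet.{u}) :
    (presSH.{u, v} K r n I).Z X = Subcx.relCycles (((RC.{u, v} K).obj X).FL (Ivl.pres I).R)
      (((RC.{u, v} K).obj X).FL (Ivl.shift (Ivl.pres I).L (-r))) n := rfl

theorem presSH_B (r : ℝ≥0) (n : ℕ) (I : Set ℝ) (X : QMet.{u}) :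
    (presSH.{u, v} K r n I).B X =
      Subcx.relBoundaries (((RC.{u, v} K).obj X).FL (Ivl.shift (Ivl.pres I).R r))
        (((RC.{u, v} K).obj X).FL (Ivl.pres I).L) n := rfl

/-- The presentation of magnitude homology. -/
def presMH (n : ℕ) (ℓ : ℝ) :
    Pres (RC.{u, v} K ⋙ FiltCx.forget K ℝ ⋙ HomologicalComplex.eval _ _ n) (MH K n ℓ) :=
  ((cxPresStageQuot ℓ).homology n).precomp (RC.{u, v} K)

theorem presMH_Z (n : ℕ) (ℓ : ℝ) (X : QMet.{u}) :
    (presMH.{u, v} K n ℓ).Z X = Subcx.relCycles (((RC.{u, v} K).obj X).F ℓ)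
      (((RC.{u, v} K).obj X).FL (LowerSet.Iio ℓ)) n := rfl

theorem presMH_B (n : ℕ) (ℓ : ℝ) (X : QMet.{u}) :
    (presMH.{u, v} K n ℓ).B X = Subcx.relBoundaries (((RC.{u, v} K).obj X).F ℓ)
      (((RC.{u, v} K).obj X).FL (LowerSet.Iio ℓ)) n := rfl

/-- Magnitude homology is `SH⁰` of a point. -/
def isoMH (n : ℕ) (ℓ : ℝ) : (MH K n ℓ : QMet.{u} ⥤ ModuleCat.{max u v} K) ≅ SH K 0 n {ℓ} :=
  (presMH.{u, v} K n ℓ).iso (presSH.{u, v} K 0 n {ℓ})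
    (fun X => by
      rw [presMH_Z, presSH_Z, Ivl.pres_singleton, NNReal.coe_zero, neg_zero, Ivl.shift_zero,
        FiltCx.FL_Iic])
    (fun X => by
      rw [presMH_Z, presSH_Z, presMH_B, presSH_B, Ivl.pres_singleton, NNReal.coe_zero, neg_zero,
        Ivl.shift_zero, Ivl.shift_zero, FiltCx.FL_Iic])

/-- The presentation of `H_n(C_I)`, for the reachability complex. -/
def presHnRC (n : ℕ) (I : Ivl) :
    Pres (RC.{u, v} K ⋙ FiltCx.forget K ℝ ⋙ HomologicalComplex.eval _ _ n)
      (RC.{u, v} K ⋙ Prod.sectL _ I ⋙ 𝟭 (FiltCx K ℝ × Ivl) ⋙ cxIvl K ⋙ Hn K n) :=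
  (presHnIvlSelf n).precomp (RC.{u, v} K ⋙ Prod.sectL _ I)

/-- Magnitude homology is the homology of `C_I`, where `I` is a point. -/
def hnPointIsoMH (n : ℕ) (ℓ : ℝ) : (RC.{u, v} K ⋙ Prod.sectL _ (Ivl.pres {ℓ}) ⋙
    𝟭 (FiltCx K ℝ × Ivl) ⋙ cxIvl K ⋙ Hn K n) ≅ MH K n ℓ :=
  (presHnRC.{u, v} K n (Ivl.pres {ℓ})).iso (presMH.{u, v} K n ℓ)
    (fun X => by
      change Subcx.relCycles (((RC.{u, v} K).obj X).FL (Ivl.pres {ℓ}).R)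
        (((RC.{u, v} K).obj X).FL (Ivl.pres {ℓ}).L) n = _
      rw [presMH_Z, Ivl.pres_singleton, FiltCx.FL_Iic])
    (fun X => by
      change Subcx.relCycles (((RC.{u, v} K).obj X).FL (Ivl.pres {ℓ}).R)
        (((RC.{u, v} K).obj X).FL (Ivl.pres {ℓ}).L) n ⊓ Subcx.relBoundaries
        (((RC.{u, v} K).obj X).FL (Ivl.pres {ℓ}).R)
        (((RC.{u, v} K).obj X).FL (Ivl.pres {ℓ}).L) n = _
      rw [presMH_Z, presMH_B, Ivl.pres_singleton]
      dsimp only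
      rw [FiltCx.FL_Iic]
      rfl)

theorem IsSubquotient.precomp {I J : Type*} [Category I] [Category J] {A B : J ⥤ ModuleCat.{w} K}
    (h : IsSubquotient A B) (F : I ⥤ J) : IsSubquotient (F ⋙ A) (F ⋙ B) := by
  obtain ⟨Z, i, p, hi, hp⟩ := h
  rw [NatTrans.mono_iff_mono_app] at hi
  rw [NatTrans.epi_iff_epi_app] at hp
  have hi' : ∀ j, Mono ((Functor.whiskerLeft F i).app j) := fun j => hi (F.obj j)
  have hp' : ∀ j, Epi ((Functor.whiskerLeft F p).app j) := fun j => hp (F.obj j)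
  exact ⟨F ⋙ Z, Functor.whiskerLeft F i, Functor.whiskerLeft F p,
    NatTrans.mono_of_mono_app _, NatTrans.epi_of_epi_app _⟩

theorem isSubquotient_SH_MH (r : ℝ≥0) (n : ℕ) (ℓ : ℝ) :
    IsSubquotient (SH K r n {ℓ}) (MH K n ℓ : QMet.{u} ⥤ ModuleCat.{max u v} K) :=
  IsSubquotient.of_iso (((isSubquotient_imModKer _ _).precomp K _).precomp K _)
    (Iso.refl (SH K r n {ℓ})) (hnPointIsoMH.{u, v} K n ℓ)

section Persistent

variable {C D E P Q : Type*} [Category C] [Category D] [Category E] [Category P] [Category Q]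

/-- A functor of two variables, precomposed in each variable. -/
def curryProdIso (F : C ⥤ D) (W : P ⥤ Q) (H : D × Q ⥤ E) :
    Functor.curry.obj (F.prod W ⋙ H) ≅
      F ⋙ Functor.curry.obj H ⋙ (Functor.whiskeringLeft _ _ _).obj W :=
  NatIso.ofComponents
    (fun c => NatIso.ofComponents (fun p => Iso.refl _) (fun f => by simp))
    (fun f => by ext p; simp)

end Persistent

/-- `PSH` as a functor of two variables. -/
def isoPSH (r : ℝ≥0) (n : ℕ) :
    Functor.curry.obj ((RC.{u, v} K).prod Ivl.iic ⋙ SHC K r n) ≅ PSH K r n :=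
  curryProdIso _ _ _

/-- `BMH` as a functor of two variables. -/
def isoBMH (n : ℕ) :
    Functor.curry.obj ((RC.{u, v} K).prod (𝟭 ℝ) ⋙ FiltCx.stage ⋙ Hn K n) ≅ BMH K n :=
  curryProdIso _ _ _

/-- The functor `(X, ℓ) ↦ RC_n(X)`. -/
abbrev rcFst (n : ℕ) : QMet.{u} × ℝ ⥤ ModuleCat.{max u v} K :=
  CategoryTheory.Prod.fst _ _ ⋙ RC.{u, v} K ⋙ FiltCx.forget K ℝ ⋙ HomologicalComplex.eval _ _ n

/-- The presentation of `SH^r_{n,(-∞,ℓ]}(X)`, for variable `ℓ`. -/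
def presPSH (r : ℝ≥0) (n : ℕ) :
    Pres (rcFst.{u, v} K n) ((RC.{u, v} K).prod Ivl.iic ⋙ SHC K r n) :=
  (presSHC r n).precomp ((RC.{u, v} K).prod Ivl.iic)

/-- The presentation of `H_n(F_ℓ RC(X))`, for variable `ℓ`. -/
def presBMH (n : ℕ) :
    Pres (rcFst.{u, v} K n) ((RC.{u, v} K).prod (𝟭 ℝ) ⋙ FiltCx.stage ⋙ Hn K n) :=
  (cxPresStage.homology n).precomp ((RC.{u, v} K).prod (𝟭 ℝ))

/-- The presentation of `H_n(C_{(-∞,ℓ]})`, for variable `ℓ`. -/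
def presHnIic (n : ℕ) :
    Pres (rcFst.{u, v} K n)
      ((RC.{u, v} K).prod Ivl.iic ⋙ 𝟭 (FiltCx K ℝ × Ivl) ⋙ cxIvl K ⋙ Hn K n) :=
  (presHnIvlSelf n).precomp ((RC.{u, v} K).prod Ivl.iic)

/-- `H_n(F_ℓ)` is `SH⁰` of the interval `(-∞, ℓ]`. -/
def isoStage (n : ℕ) : ((RC.{u, v} K).prod (𝟭 ℝ) ⋙ FiltCx.stage ⋙ Hn K n) ≅
    (RC.{u, v} K).prod Ivl.iic ⋙ SHC K 0 n :=
  (presBMH.{u, v} K n).iso (presPSH.{u, v} K 0 n)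
    (fun p => by
      change Subcx.relCycles (((RC.{u, v} K).obj p.1).F p.2) (Subcx.bot _) n =
        Subcx.relCycles (((RC.{u, v} K).obj p.1).FL (Ivl.pres (Set.Iic p.2)).R)
          (((RC.{u, v} K).obj p.1).FL (Ivl.shift (Ivl.pres (Set.Iic p.2)).L (-(0 : ℝ≥0)))) n
      rw [Ivl.pres_Iic, Ivl.shift_bot, FiltCx.FL_Iic, FiltCx.FL_bot])
    (fun p => by
      change Subcx.relCycles (((RC.{u, v} K).obj p.1).F p.2) (Subcx.bot _) n ⊓
          Subcx.relBoundaries (((RC.{u, v} K).obj p.1).F p.2) (Subcx.bot _) n =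
        Subcx.relCycles (((RC.{u, v} K).obj p.1).FL (Ivl.pres (Set.Iic p.2)).R)
          (((RC.{u, v} K).obj p.1).FL (Ivl.shift (Ivl.pres (Set.Iic p.2)).L (-(0 : ℝ≥0)))) n ⊓
        Subcx.relBoundaries
          (((RC.{u, v} K).obj p.1).FL (Ivl.shift (Ivl.pres (Set.Iic p.2)).R (0 : ℝ≥0)))
          (((RC.{u, v} K).obj p.1).FL (Ivl.pres (Set.Iic p.2)).L) n
      rw [Ivl.pres_Iic, Ivl.shift_bot, NNReal.coe_zero, Ivl.shift_zero, FiltCx.FL_Iic,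
        FiltCx.FL_bot])

/-- `H_n(F_ℓ)` is the homology of `C_I` for `I = (-∞, ℓ]`. -/
def hnIicIsoStage (n : ℕ) :
    ((RC.{u, v} K).prod Ivl.iic ⋙ 𝟭 (FiltCx K ℝ × Ivl) ⋙ cxIvl K ⋙ Hn K n) ≅
      (RC.{u, v} K).prod (𝟭 ℝ) ⋙ FiltCx.stage ⋙ Hn K n :=
  (presHnIic.{u, v} K n).iso (presBMH.{u, v} K n)
    (fun p => by
      change Subcx.relCycles (((RC.{u, v} K).obj p.1).FL (Ivl.pres (Set.Iic p.2)).R)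
          (((RC.{u, v} K).obj p.1).FL (Ivl.pres (Set.Iic p.2)).L) n =
        Subcx.relCycles (((RC.{u, v} K).obj p.1).F p.2) (Subcx.bot _) n
      rw [Ivl.pres_Iic, FiltCx.FL_Iic, FiltCx.FL_bot])
    (fun p => by
      change Subcx.relCycles (((RC.{u, v} K).obj p.1).FL (Ivl.pres (Set.Iic p.2)).R)
          (((RC.{u, v} K).obj p.1).FL (Ivl.pres (Set.Iic p.2)).L) n ⊓
        Subcx.relBoundaries (((RC.{u, v} K).obj p.1).FL (Ivl.pres (Set.Iic p.2)).R)
          (((RC.{u, v} K).obj p.1).FL (Ivl.pres (Set.Iic p.2)).L) n =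
        Subcx.relCycles (((RC.{u, v} K).obj p.1).F p.2) (Subcx.bot _) n ⊓
          Subcx.relBoundaries (((RC.{u, v} K).obj p.1).F p.2) (Subcx.bot _) n
      rw [Ivl.pres_Iic, FiltCx.FL_Iic, FiltCx.FL_bot])

/-- Blurred magnitude homology is `PSH⁰`. -/
def isoBMHPSH (n : ℕ) : (BMH K n : QMet.{u} ⥤ ℝ ⥤ ModuleCat.{max u v} K) ≅ PSH K 0 n :=
  (isoBMH.{u, v} K n).symm ≪≫ Functor.curry.mapIso (isoStage.{u, v} K n) ≪≫ isoPSH.{u, v} K 0 n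

theorem isSubquotient_PSH_BMH (r : ℝ≥0) (n : ℕ) :
    IsSubquotient (PSH K r n) (BMH K n : QMet.{u} ⥤ ℝ ⥤ ModuleCat.{max u v} K) := by
  have h : IsSubquotient ((RC.{u, v} K).prod Ivl.iic ⋙ SHC K r n)
      ((RC.{u, v} K).prod (𝟭 ℝ) ⋙ FiltCx.stage ⋙ Hn K n) :=
    IsSubquotient.of_iso ((isSubquotient_imModKer _ _).precomp K _) (Iso.refl _)
      (hnIicIsoStage.{u, v} K n)
  exact (h.map_equivalence Functor.currying.symm).of_iso (isoPSH.{u, v} K r n) (isoBMH.{u, v} K n)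

/-- Over the interval `ℝ`, spectral homology is the homology of the reachability complex. -/
def isoSHUniv (r : ℝ≥0) (n : ℕ) :
    (RC.{u, v} K ⋙ FiltCx.forget K ℝ ⋙ Hn K n) ≅ SH K r n Set.univ :=
  have hT : ∀ X : QMet.{u}, ((RC.{u, v} K).obj X).FL ⊤ = ⟨fun _ => ⊤, fun _ _ => le_top⟩ := fun X =>
    Subcx.ext_mod fun n => by
      rw [FL_RC_mod]
      exact Finsupp.supported_univ
  ((cxPresSelf (RC.{u, v} K ⋙ FiltCx.forget K ℝ)).homology n).iso (presSH.{u, v} K r n Set.univ)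
    (fun X => by
      rw [presSH_Z, Ivl.pres_univ, Ivl.shift_bot, FiltCx.FL_bot, hT]
      rfl)
    (fun X => by
      rw [presSH_Z, presSH_B, Ivl.pres_univ, Ivl.shift_bot, Ivl.shift_top, FiltCx.FL_bot, hT]
      rfl)

end

/-! ### The prism operator and homotopy invariance -/

section Prism

variable {α β : Type*}

/-- The tuple `(f x₀, …, f xᵢ, g xᵢ, …, g xₖ)`. -/
def prism (f g : α → β) : ∀ {k : ℕ}, Fin k → (Fin k → α) → Fin (k + 1) → β
  | k + 1, i, x => Fin.cons (f (x 0)) (Fin.cases (motive := fun _ => Fin (k + 1) → β)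
      (fun j => g (x j)) (fun j => prism f g j fun m => x m.succ) i)

theorem prism_zero (f g : α → β) {k : ℕ} (x : Fin (k + 1) → α) :
    prism f g 0 x = Fin.cons (α := fun _ => β) (f (x 0)) fun j => g (x j) := rfl

theorem prism_succ (f g : α → β) {k : ℕ} (i : Fin k) (x : Fin (k + 1) → α) :
    prism f g i.succ x = Fin.cons (α := fun _ => β) (f (x 0)) (prism f g i fun m => x m.succ) := by
  rfl

theorem removeNth_zero_cons {n : ℕ} (a : β) (y : Fin n → β) :
    (0 : Fin (n + 1)).removeNth (Fin.cons (α := fun _ => β) a y) = y := by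
  funext k
  simp [Fin.removeNth]

theorem removeNth_succ_cons {n : ℕ} (j : Fin (n + 1)) (a : β) (y : Fin (n + 1) → β) :
    j.succ.removeNth (Fin.cons (α := fun _ => β) a y) =
      Fin.cons (α := fun _ => β) a (j.removeNth y) := by
  funext k
  refine Fin.cases ?_ (fun k => ?_) k <;> simp [Fin.removeNth]

theorem removeNth_succ_eq_cons {n : ℕ} (j : Fin (n + 1)) (x : Fin (n + 2) → α) :
    j.succ.removeNth x = Fin.cons (α := fun _ => α) (x 0) (j.removeNth fun m => x m.succ) := by
  rw [← removeNth_succ_cons]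
  exact congrArg _ (Fin.cons_self_tail x).symm

/-- The prism identity `∂h + h∂ = g - f`, for an arbitrary function `T` of tuples: the first vertex
of every prism is `f x₀`, so that splitting off the faces that omit it reduces the identity for
`T` to that for the function `T (f x₀, ·)` of shorter tuples. -/
theorem sum_prism (K : Type*) [CommRing K] {M : Type*} [AddCommGroup M] [Module K M]
    (f g : α → β) : ∀ {k : ℕ} (T : (Fin (k + 1) → β) → M) (x : Fin (k + 1) → α),
    (∑ i : Fin (k + 1), ∑ j : Fin (k + 2),
        (-1 : K) ^ (i : ℕ) • (-1 : K) ^ (j : ℕ) • T (j.removeNth (prism f g i x))) +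
      (∑ j : Fin (k + 1), ∑ i : Fin k,
        (-1 : K) ^ (j : ℕ) • (-1 : K) ^ (i : ℕ) • T (prism f g i (j.removeNth x))) =
      T (fun j => g (x j)) - T (fun j => f (x j))
  | 0, T, x => by
    have h : (1 : Fin 2).removeNth (prism f g 0 x) = fun j => f (x j) := by
      funext j
      obtain rfl : j = 0 := Subsingleton.elim _ _
      rfl
    have h0 : (0 : Fin 2).removeNth (prism f g 0 x) = fun j => g (x j) :=
      removeNth_zero_cons _ _
    simp [Fin.sum_univ_two, -Fin.removeNth_zero, h, h0, sub_eq_add_neg]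
  | k + 1, T, x => by
    set y : Fin (k + 1) → α := fun m => x m.succ
    set T' : (Fin (k + 1) → β) → M := fun z => T (Fin.cons (α := fun _ => β) (f (x 0)) z)
    have ih := sum_prism K f g T' y
    have e1 : ∀ i : Fin (k + 1), ∑ j : Fin (k + 3), (-1 : K) ^ (i.succ : ℕ) • (-1 : K) ^ (j : ℕ) •
        T (j.removeNth (prism f g i.succ x)) = -((-1 : K) ^ (i : ℕ) • T (prism f g i y)) +
          ∑ j : Fin (k + 2), (-1 : K) ^ (i : ℕ) • (-1 : K) ^ (j : ℕ) •
            T' (j.removeNth (prism f g i y)) := by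
      intro i
      rw [Fin.sum_univ_succ, prism_succ, removeNth_zero_cons]
      simp [removeNth_succ_cons, pow_succ, T', y]
    have e0 : ∑ j : Fin (k + 3), (-1 : K) ^ (j : ℕ) • T (j.removeNth (prism f g 0 x)) =
        T (fun j => g (x j)) - (T' (fun j => g (y j)) - ∑ j : Fin (k + 1), (-1 : K) ^ (j : ℕ) •
          T (prism f g 0 (j.succ.removeNth x))) := by
      rw [Fin.sum_univ_succ, Fin.sum_univ_succ, prism_zero, removeNth_zero_cons,
        removeNth_succ_cons]
      have e2 : (0 : Fin (k + 2)).removeNth (fun j => g (x j)) = fun j => g (y j) := by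
        funext j
        simp [Fin.removeNth, y]
      have e3 : ∀ j : Fin (k + 1), j.succ.succ.removeNth
          (Fin.cons (α := fun _ => β) (f (x 0)) fun j => g (x j)) =
          prism f g 0 (j.succ.removeNth x) := by
        intro j
        rw [removeNth_succ_cons, prism_zero]
        congr 1
      simp only [e2, e3]
      simp [pow_succ, T']
      abel
    have e4 : ∑ i : Fin (k + 1), (-1 : K) ^ ((0 : Fin (k + 2)) : ℕ) • (-1 : K) ^ (i : ℕ) •
        T (prism f g i ((0 : Fin (k + 2)).removeNth x)) =
        ∑ i : Fin (k + 1), (-1 : K) ^ (i : ℕ) • T (prism f g i y) := by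
      have : (0 : Fin (k + 2)).removeNth x = y := by
        funext j
        simp [Fin.removeNth, y]
      simp [this]
    have e5 : ∀ j : Fin (k + 1), ∑ i : Fin (k + 1), (-1 : K) ^ (j.succ : ℕ) • (-1 : K) ^ (i : ℕ) •
        T (prism f g i (j.succ.removeNth x)) =
        -((-1 : K) ^ (j : ℕ) • T (prism f g 0 (j.succ.removeNth x))) + ∑ i : Fin k,
          (-1 : K) ^ (j : ℕ) • (-1 : K) ^ (i : ℕ) • T' (prism f g i (j.removeNth y)) := by
      intro j
      rw [Fin.sum_univ_succ]
      congr 1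
      · simp [pow_succ]
      · refine Finset.sum_congr rfl fun i _ => ?_
        rw [prism_succ, removeNth_succ_eq_cons]
        simp [pow_succ, T', y]
    rw [Fin.sum_univ_succ (n := k + 1), Fin.sum_univ_succ (n := k + 1), e4,
      Finset.sum_congr rfl fun i _ => e1 i, Finset.sum_congr rfl fun j _ => e5 j,
      Finset.sum_add_distrib, Finset.sum_add_distrib]
    simp only [Fin.val_zero, pow_zero, one_smul, e0, Finset.sum_neg_distrib]
    have e6 : T' (fun j => f (y j)) = T (fun j => f (x j)) :=
      congrArg T (Fin.cons_self_tail fun j => f (x j))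
    rw [e6] at ih
    rw [← sub_eq_zero] at ih ⊢
    rw [← ih]
    abel

/-- The prisms on a tuple with a consecutive repetition have consecutive repetitions, so that the
prism operator is compatible with setting such tuples to `0`. -/
theorem exists_prism_eq (f g : α → β) : ∀ {k : ℕ} (x : Fin (k + 1) → α) (j : Fin k)
    (_ : x j.castSucc = x j.succ) (i : Fin (k + 1)),
    ∃ m : Fin (k + 1), prism f g i x m.castSucc = prism f g i x m.succ
  | k + 1, x, j, h, i => by
    induction i using Fin.cases with
    | zero => exact ⟨j.succ, congrArg g h⟩
    | succ i =>
      induction j using Fin.cases with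
      | zero => exact ⟨0, congrArg f h⟩
      | succ j =>
        obtain ⟨m, hm⟩ := exists_prism_eq f g (fun m => x m.succ) j h i
        exact ⟨m.succ, hm⟩

end Prism

theorem len_prism {X Y : QMet.{u}} {φ ψ : X ⟶ Y} {r : ℝ≥0}
    (h : ∀ x, Y.dist (φ.toFun x) (ψ.toFun x) ≤ r) : ∀ {k : ℕ} (i : Fin (k + 1))
    (x : Fin (k + 1) → X.carrier), len Y (prism φ.toFun ψ.toFun i x) ≤ len X x + r
  | 0, i, x => by
    obtain rfl : i = 0 := Fin.ext (by lia)
    rw [len_succ]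
    refine le_trans ?_ le_add_self
    have h1 : len Y (fun i : Fin 1 => prism φ.toFun ψ.toFun 0 x i.succ) = 0 := by simp [len]
    rw [h1, add_zero]
    exact h (x 0)
  | k + 1, i, x => by
    induction i using Fin.cases with
    | zero =>
      rw [len_succ, add_comm]
      exact add_le_add (len_comp ψ x) (h (x 0))
    | succ i =>
      rw [len_succ (prism _ _ _ _), len_succ x]
      exact (add_le_add (φ.short _ _) (len_prism h i fun m => x m.succ)).trans_eq
        (add_assoc _ _ _).symm

section

variable (K : Type v) [CommRing K] {X Y : QMet.{u}}

/-- The prism operator `(x₀, …, xₙ) ↦ ∑ (-1)^i (φ x₀, …, φ xᵢ, ψ xᵢ, …, ψ xₙ)`. -/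
def prismMap (φ ψ : X ⟶ Y) (n : ℕ) : (RTuple X n →₀ K) →ₗ[K] (RTuple Y (n + 1) →₀ K) :=
  Finsupp.linearCombination K fun x : RTuple X n =>
    ∑ i : Fin (n + 1), (-1 : K) ^ (i : ℕ) • tup K Y (prism φ.toFun ψ.toFun i x.1)

theorem prismMap_tup (φ ψ : X ⟶ Y) {n : ℕ} {x : Fin (n + 1) → X.carrier} (hx : len X x < ∞) :
    prismMap K φ ψ n (tup K X x) =
      ∑ i : Fin (n + 1), (-1 : K) ^ (i : ℕ) • tup K Y (prism φ.toFun ψ.toFun i x) := by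
  by_cases h : IsRegular X x
  · rw [tup_of_regular K h, prismMap, Finsupp.linearCombination_single, one_smul]
  · obtain ⟨j, hj⟩ : ∃ j : Fin n, x j.castSucc = x j.succ := by
      by_contra hne
      exact h ((isRegular_iff x).2 ⟨fun i e => hne ⟨i, e⟩, hx⟩)
    rw [tup_of_not_regular K h, map_zero, Finset.sum_eq_zero]
    intro i _
    obtain ⟨m, hm⟩ := exists_prism_eq φ.toFun ψ.toFun x j hj i
    rw [tup_of_not_regular K fun hreg => (hreg m).1 hm, smul_zero]

variable {φ ψ : X ⟶ Y} {r : ℝ≥0} (h : ∀ x, Y.dist (φ.toFun x) (ψ.toFun x) ≤ r)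

include h

theorem rcD_prismMap_tup {n : ℕ} {x : Fin (n + 1) → X.carrier} (hx : len X x < ∞) :
    rcD K Y n (prismMap K φ ψ n (tup K X x)) = ∑ i : Fin (n + 1), ∑ j : Fin (n + 2),
      (-1 : K) ^ (i : ℕ) • (-1 : K) ^ (j : ℕ) •
        tup K Y (j.removeNth (prism φ.toFun ψ.toFun i x)) := by
  rw [prismMap_tup K φ ψ hx, map_sum]
  refine Finset.sum_congr rfl fun i _ => ?_
  have hl : len Y (prism φ.toFun ψ.toFun i x) < ∞ :=
    (len_prism h i x).trans_lt (ENNReal.add_lt_top.2 ⟨hx, ENNReal.coe_lt_top⟩)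
  rw [map_smul, rcD_tup K hl, Finset.smul_sum]

theorem rcD_prismMap_zero : rcD K Y 0 ∘ₗ prismMap K φ ψ 0 = rcMap K ψ 0 - rcMap K φ 0 := by
  refine Finsupp.lhom_ext' fun x => LinearMap.ext_ring ?_
  have hx : len X x.1 < ∞ := ((isRegular_iff x.1).1 x.2).2
  simp only [LinearMap.comp_apply, Finsupp.lsingle_apply, LinearMap.sub_apply]
  rw [← tup_of_regular K x.2, rcD_prismMap_tup K h hx, rcMap_tup K _ hx, rcMap_tup K _ hx,
    ← sum_prism K φ.toFun ψ.toFun (tup K Y) x.1]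
  simp

theorem rcD_prismMap_succ (n : ℕ) : rcD K Y (n + 1) ∘ₗ prismMap K φ ψ (n + 1) +
    prismMap K φ ψ n ∘ₗ rcD K X n = rcMap K ψ (n + 1) - rcMap K φ (n + 1) := by
  refine Finsupp.lhom_ext' fun x => LinearMap.ext_ring ?_
  have hx : len X x.1 < ∞ := ((isRegular_iff x.1).1 x.2).2
  simp only [LinearMap.comp_apply, Finsupp.lsingle_apply, LinearMap.sub_apply, LinearMap.add_apply]
  rw [← tup_of_regular K x.2, rcD_prismMap_tup K h hx, rcMap_tup K _ hx, rcMap_tup K _ hx,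
    ← sum_prism K φ.toFun ψ.toFun (tup K Y) x.1, rcD_tup K hx, map_sum]
  congr 1
  refine Finset.sum_congr rfl fun j _ => ?_
  rw [map_smul, prismMap_tup K φ ψ ((len_removeNth _ _).trans_lt hx), Finset.smul_sum]

/-- The prism operator raises the filtration degree by at most `r`. -/
theorem prismMap_mem_FL (L : LowerSet ℝ) (n : ℕ) {z : RTuple X n →₀ K}
    (hz : z ∈ (((RC.{u, v} K).obj X).FL L).mod n) :
    prismMap K φ ψ n z ∈ (((RC.{u, v} K).obj Y).FL (Ivl.shift L r)).mod (n + 1) := by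
  rw [FL_RC_mod] at hz ⊢
  refine supported_le_comap (P := fun x : RTuple X n => (len X x.1).toReal ∈ L)
    (f := prismMap K φ ψ n) (S := Finsupp.supported K K
      {y : RTuple Y (n + 1) | (len Y y.1).toReal ∈ Ivl.shift L r}) K (fun x hx => ?_) hz
  have hlt := ((isRegular_iff x.1).1 x.2).2
  rw [prismMap_tup K φ ψ hlt]
  refine Submodule.sum_mem _ fun i _ => Submodule.smul_mem _ _
    (tup_mem_supported (P := fun y : RTuple Y (n + 1) => (len Y y.1).toReal ∈ Ivl.shift L r) K
      fun hy => ?_)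
  refine L.lower ?_ hx
  have h1 := ENNReal.toReal_mono (ENNReal.add_lt_top.2 ⟨hlt, ENNReal.coe_lt_top⟩).ne
    (len_prism h i x.1)
  rw [ENNReal.toReal_add hlt.ne ENNReal.coe_ne_top, ENNReal.coe_toReal] at h1
  exact sub_le_iff_le_add.2 h1

/-- On the numerators of `SH^r_{n,I}`, the maps induced by `φ` and `ψ` differ by an element of the
denominators. -/
theorem rcMap_sub_rcMap_mem (I : Ivl) (n : ℕ) {z : RTuple X n →₀ K}
    (hz : z ∈ Subcx.relCycles (((RC.{u, v} K).obj X).FL I.R)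
      (((RC.{u, v} K).obj X).FL (Ivl.shift I.L (-r))) n) :
    (rcMap K ψ n z - rcMap K φ n z : RTuple Y n →₀ K) ∈
      Subcx.relBoundaries (((RC.{u, v} K).obj Y).FL (Ivl.shift I.R r))
        (((RC.{u, v} K).obj Y).FL I.L) n := by
  obtain ⟨h1, h2⟩ := Subcx.mem_relCycles.1 hz
  refine Subcx.mem_relBoundaries.2 ⟨prismMap K φ ψ n z, prismMap_mem_FL K h _ n h1, ?_⟩
  have hd : ((((RC.{u, v} K).obj Y).cx.d (n + 1) n).hom (prismMap K φ ψ n z) :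
      RTuple Y n →₀ K) = rcD K Y n (prismMap K φ ψ n z) :=
    congrArg (fun k => k.hom (prismMap K φ ψ n z)) (rcCx_d K n)
  cases n with
  | zero =>
    have e := LinearMap.congr_fun (rcD_prismMap_zero K h) z
    simp only [LinearMap.comp_apply, LinearMap.sub_apply] at e
    refine (congrArg (· ∈ (((RC.{u, v} K).obj Y).FL I.L).mod 0)
      (sub_eq_zero_of_eq (hd.trans e).symm)).mpr (zero_mem _)
  | succ n =>
    have e := LinearMap.congr_fun (rcD_prismMap_succ K h n) z
    simp only [LinearMap.comp_apply, LinearMap.sub_apply, LinearMap.add_apply] at e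
    have hd' : ((((RC.{u, v} K).obj X).cx.d (n + 1) n).hom z : RTuple X n →₀ K) = rcD K X n z :=
      congrArg (fun k => k.hom z) (rcCx_d K n)
    have h3 := (congrArg (· ∈ (((RC.{u, v} K).obj X).FL (Ivl.shift I.L (-r))).mod n) hd').mp (h2 n)
    have h4 := prismMap_mem_FL K h _ n h3
    rw [Ivl.shift_neg_shift] at h4
    exact (congrArg (· ∈ (((RC.{u, v} K).obj Y).FL I.L).mod (n + 1))
      ((congrArg₂ (fun a b : RTuple Y (n + 1) →₀ K => a - b) e.symm hd).trans
        (add_sub_cancel_left _ _))).mpr h4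

theorem SHC_map_eq (I : Ivl) (n : ℕ) :
    (SHC K r n).map (((RC.{u, v} K).map φ, 𝟙 I) : ((RC K).obj X, I) ⟶ ((RC K).obj Y, I)) =
      (SHC K r n).map (((RC.{u, v} K).map ψ, 𝟙 I) : ((RC K).obj X, I) ⟶ ((RC K).obj Y, I)) := by
  ext a
  obtain ⟨z, rfl⟩ := (presSHC.{v, max u v} r n).surj ((RC.{u, v} K).obj X, I) a
  rw [(presSHC.{v, max u v} r n).nat, (presSHC.{v, max u v} r n).nat, eq_comm, Pres.p_eq_iff]
  exact rcMap_sub_rcMap_mem K h I n z.2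

end

/-- It suffices to compare short maps at distance at most `r`. -/
theorem QMet.homotopyInvariant_of_dist_le {r : ℝ≥0} {A : Type*} [Category A] (T : QMet.{u} ⥤ A)
    (hT : ∀ (X Y : QMet.{u}) (φ ψ : X ⟶ Y), (∀ x, Y.dist (φ.toFun x) (ψ.toFun x) ≤ r) →
      T.map φ = T.map ψ) : QMet.HomotopyInvariant r T := by
  have key : ∀ (X Y : QMet.{u}) (φ ψ : X ⟶ Y), QMet.Homotopic r φ ψ → T.map φ = T.map ψ := by
    intro X Y φ ψ h
    induction h with
    | refl => rfl
    | tail _ hstep ih =>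
      refine ih.trans ?_
      rcases hstep with hs | hs
      · exact hT _ _ _ _ fun x => (le_iSup (fun x => Y.dist _ _) x).trans hs
      · exact (hT _ _ _ _ fun x => (le_iSup (fun x => Y.dist _ _) x).trans hs).symm
  refine ⟨key, fun X Y ⟨φ, ψ, h1, h2⟩ => ⟨⟨T.map φ, T.map ψ, ?_, ?_⟩⟩⟩
  · rw [← T.map_comp, key _ _ _ _ h1, T.map_id]
  · rw [← T.map_comp, key _ _ _ _ h2, T.map_id]

theorem homotopyInvariant_SH (K : Type v) [CommRing K] (r : ℝ≥0) (n : ℕ) (I : Set ℝ) :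
    QMet.HomotopyInvariant r (SH K r n I : QMet.{u} ⥤ ModuleCat.{max u v} K) :=
  QMet.homotopyInvariant_of_dist_le _ fun _ _ _ _ h => SHC_map_eq K h _ n

theorem homotopyInvariant_PSH (K : Type v) [CommRing K] (r : ℝ≥0) (n : ℕ) :
    QMet.HomotopyInvariant r (PSH K r n : QMet.{u} ⥤ ℝ ⥤ ModuleCat.{max u v} K) :=
  QMet.homotopyInvariant_of_dist_le _ fun _ _ _ _ h =>
    NatTrans.ext (funext fun _ => SHC_map_eq K h _ n)

/-! ### Digraphs: the magnitude-path spectral sequence and path homology -/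

namespace Digr

variable (G : Digr.{u})

/-- A finite distance is the length of a shortest path. -/
theorem exists_pathDist_eq {x y : G.vertex} (h : G.pathDist x y < ∞) :
    ∃ k : ℕ, G.HasPath k x y ∧ G.pathDist x y = k := by
  classical
  have hne : ∃ k, G.HasPath k x y := by
    by_contra hne
    refine h.ne (top_le_iff.1 (le_iInf₂ fun k hk => (hne ⟨k, hk⟩).elim))
  refine ⟨Nat.find hne, Nat.find_spec hne, le_antisymm ?_ ?_⟩
  · exact iInf₂_le (f := fun (k : ℕ) (_ : G.HasPath k x y) => (k : ℝ≥0∞)) (Nat.find hne)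
      (Nat.find_spec hne)
  exact le_iInf₂ fun k hk => Nat.cast_le.2 (Nat.find_min' hne hk)

theorem arrow_of_pathDist_eq_one {x y : G.vertex} (h : G.pathDist x y = 1) : G.arrow x y := by
  obtain ⟨k, hk, hd⟩ := G.exists_pathDist_eq (h.trans_lt ENNReal.one_lt_top)
  obtain rfl : k = 1 := by
    rw [h] at hd
    exact_mod_cast hd.symm
  obtain ⟨z, hz, rfl⟩ := hk
  exact hz

theorem pathDist_le_one {x y : G.vertex} (h : G.arrow x y) : G.pathDist x y ≤ 1 := by
  have h1 : G.HasPath 1 x y := ⟨y, h, rfl⟩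
  exact (iInf₂_le 1 h1).trans_eq Nat.cast_one

/-- The consecutive distances in a generator of the reachability complex of a digraph are positive
integers. -/
theorem exists_nat_dist {n : ℕ} (x : RTuple (toQMet.obj G) n) :
    ∃ c : Fin n → ℕ, (∀ i, 1 ≤ c i) ∧
      (∀ i, G.pathDist (x.1 i.castSucc) (x.1 i.succ) = c i) ∧
      len (toQMet.obj G) x.1 = (∑ i, c i : ℕ) := by
  choose c _ hd using fun i => G.exists_pathDist_eq (x.2 i).2
  refine ⟨c, fun i => Nat.one_le_iff_ne_zero.2 fun h0 => (x.2 i).1 ?_, hd, ?_⟩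
  · refine ((toQMet.obj G).dist_eq_zero _ _).1 ((hd i).trans ?_)
    rw [h0, Nat.cast_zero]
  · rw [Nat.cast_sum]
    exact Finset.sum_congr rfl fun i _ => hd i

theorem le_len {n : ℕ} (x : RTuple (toQMet.obj G) n) :
    (n : ℝ) ≤ (len (toQMet.obj G) x.1).toReal := by
  obtain ⟨c, hc, _, hl⟩ := G.exists_nat_dist x
  rw [hl, ENNReal.toReal_natCast, Nat.cast_le]
  simpa using Finset.sum_le_sum fun i (_ : i ∈ Finset.univ) => hc i

/-- The tuples of `n` steps and length at most `n` are the allowed paths. -/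
theorem len_le_iff {n : ℕ} (x : RTuple (toQMet.obj G) n) :
    (len (toQMet.obj G) x.1).toReal ≤ n ↔
      ∀ i : Fin n, G.arrow (x.1 i.castSucc) (x.1 i.succ) := by
  obtain ⟨c, hc, hd, hl⟩ := G.exists_nat_dist x
  rw [hl, ENNReal.toReal_natCast, Nat.cast_le]
  constructor
  · intro h i
    have h1 : ∑ _i : Fin n, 1 = ∑ i, c i := le_antisymm (Finset.sum_le_sum fun i _ => hc i)
      (h.trans_eq (by simp))
    have h2 := (Finset.sum_eq_sum_iff_of_le fun i _ => hc i).1 h1 i (Finset.mem_univ i)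
    refine G.arrow_of_pathDist_eq_one ((hd i).trans ?_)
    rw [← h2, Nat.cast_one]
  · intro h
    refine (Finset.sum_le_sum fun i _ => ?_).trans_eq (by simp : ∑ _i : Fin n, 1 = n)
    have h1 := G.pathDist_le_one (h i)
    rw [hd i] at h1
    exact_mod_cast h1

end Digr

section

variable (K : Type v) [CommRing K] (G : Digr.{u})

/-- Lengths in a digraph are integers. -/
theorem FL_Iio_intCast (m : ℤ) :
    ((RC.{u, v} K).obj (Digr.toQMet.obj G)).FL (LowerSet.Iio (m : ℝ)) =
      ((RC.{u, v} K).obj (Digr.toQMet.obj G)).F ((m - 1 : ℤ) : ℝ) := by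
  rw [← FiltCx.FL_Iic]
  refine FL_RC_congr K _ fun n x => ?_
  obtain ⟨c, _, _, hl⟩ := G.exists_nat_dist x
  rw [hl, ENNReal.toReal_natCast, LowerSet.mem_Iio_iff, LowerSet.mem_Iic_iff,
    ← Int.cast_natCast, Int.cast_lt, Int.cast_le, Int.le_sub_one_iff]

/-- The presentation of the terms of the magnitude-path spectral sequence. -/
def presMPSS (r : ℕ) (hr : 1 ≤ r) (n : ℕ) (ℓ : ℤ) :
    Pres (Digr.toQMet ⋙ RC.{u, v} K ⋙ FiltCx.forget K ℝ ⋙ HomologicalComplex.eval _ _ n)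
      (MPSS K r hr n ℓ) :=
  (presSSPage r hr n ℓ).precomp (RCZ.{u, v} K)

theorem presMPSS_Z (r : ℕ) (hr : 1 ≤ r) (n : ℕ) (ℓ : ℤ) :
    (presMPSS.{u, v} K r hr n ℓ).Z G =
      Subcx.relCycles (((RC.{u, v} K).obj (Digr.toQMet.obj G)).F (ℓ : ℝ))
        (((RC.{u, v} K).obj (Digr.toQMet.obj G)).F ((ℓ - r : ℤ) : ℝ)) n :=
  rfl

theorem presMPSS_B (r : ℕ) (hr : 1 ≤ r) (n : ℕ) (ℓ : ℤ) :
    (presMPSS.{u, v} K r hr n ℓ).B G =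
      Subcx.relBoundaries (((RC.{u, v} K).obj (Digr.toQMet.obj G)).F ((ℓ + r - 1 : ℤ) : ℝ))
        (((RC.{u, v} K).obj (Digr.toQMet.obj G)).F ((ℓ - 1 : ℤ) : ℝ)) n :=
  rfl

theorem presSH_singleton_Z (r : ℝ≥0) (n : ℕ) (ℓ : ℝ) (X : QMet.{u}) :
    (presSH.{u, v} K r n {ℓ}).Z X =
      Subcx.relCycles (((RC.{u, v} K).obj X).F ℓ)
        (((RC.{u, v} K).obj X).FL (LowerSet.Iio (ℓ - r))) n := by
  rw [presSH_Z, Ivl.pres_singleton, Ivl.shift_Iio, FiltCx.FL_Iic, sub_eq_add_neg]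

theorem presSH_singleton_B (r : ℝ≥0) (n : ℕ) (ℓ : ℝ) (X : QMet.{u}) :
    (presSH.{u, v} K r n {ℓ}).B X =
      Subcx.relBoundaries (((RC.{u, v} K).obj X).F (ℓ + r))
        (((RC.{u, v} K).obj X).FL (LowerSet.Iio ℓ)) n := by
  rw [presSH_B, Ivl.pres_singleton, Ivl.shift_Iic, FiltCx.FL_Iic]

theorem presMPSS_Z_eq (r : ℕ) (hr : 1 ≤ r) (n : ℕ) (ℓ : ℤ) :
    (presMPSS.{u, v} K r hr n ℓ).Z G =
      (presSH.{u, v} K ((r - 1 : ℕ) : ℝ≥0) n {(ℓ : ℝ)}).Z (Digr.toQMet.obj G) := by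
  have e : (ℓ : ℝ) - (((r - 1 : ℕ) : ℝ≥0) : ℝ) = ((ℓ - r + 1 : ℤ) : ℝ) := by
    rw [NNReal.coe_natCast, Nat.cast_sub hr]
    push_cast
    ring
  rw [presMPSS_Z, presSH_singleton_Z, e, FL_Iio_intCast, add_sub_cancel_right]

theorem presMPSS_B_eq (r : ℕ) (hr : 1 ≤ r) (n : ℕ) (ℓ : ℤ) :
    (presMPSS.{u, v} K r hr n ℓ).B G =
      (presSH.{u, v} K ((r - 1 : ℕ) : ℝ≥0) n {(ℓ : ℝ)}).B (Digr.toQMet.obj G) := by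
  have e : (ℓ : ℝ) + (((r - 1 : ℕ) : ℝ≥0) : ℝ) = ((ℓ + r - 1 : ℤ) : ℝ) := by
    rw [NNReal.coe_natCast, Nat.cast_sub hr]
    push_cast
    ring
  rw [presMPSS_B, presSH_singleton_B, e, FL_Iio_intCast]

/-- The terms of the magnitude-path spectral sequence are spectral homology of points. -/
def isoMPSS (r : ℕ) (hr : 1 ≤ r) (n : ℕ) (ℓ : ℤ) :
    (MPSS K r hr n ℓ : Digr.{u} ⥤ ModuleCat.{max u v} K) ≅
      Digr.toQMet ⋙ SH K ((r - 1 : ℕ) : ℝ≥0) n {(ℓ : ℝ)} :=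
  (presMPSS.{u, v} K r hr n ℓ).iso ((presSH.{u, v} K _ n {(ℓ : ℝ)}).precomp Digr.toQMet)
    (fun G => presMPSS_Z_eq K G r hr n ℓ)
    (fun G => congrArg₂ (· ⊓ ·) (presMPSS_Z_eq K G r hr n ℓ) (presMPSS_B_eq K G r hr n ℓ))

theorem F_digraph_eq_allowed (n : ℕ) :
    (((RC.{u, v} K).obj (Digr.toQMet.obj G)).F (n : ℝ)).mod n = allowed K G n :=
  (rcF_mod K _ _ n).trans (congrArg (Finsupp.supported K K) (Set.ext fun x => G.len_le_iff x))

theorem FL_Iio_digraph_eq_bot {a : ℝ} {n : ℕ} (h : a ≤ n) :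
    (((RC.{u, v} K).obj (Digr.toQMet.obj G)).FL (LowerSet.Iio a)).mod n = ⊥ := by
  rw [FL_RC_mod]
  refine (congrArg (Finsupp.supported K K) (Set.ext fun x => ?_)).trans
    Finsupp.supported_empty
  exact ⟨fun hx => absurd (G.le_len x) (not_le.2 ((LowerSet.mem_Iio_iff.1 hx).trans_le h)),
    fun hx => hx.elim⟩

variable {K} in
theorem d_mem_of_forall_ne {C : ChainComplex (ModuleCat.{w} K) ℕ} {n m : ℕ} (h : m + 1 ≠ n)
    (S : Submodule K (C.X m)) (x : C.X n) : (C.d n m).hom x ∈ S := by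
  rw [C.shape n m h]
  exact zero_mem _

variable {K} in
theorem mem_core {C : ChainComplex (ModuleCat.{w} K) ℕ} {A : ∀ n : ℕ, Submodule K (C.X n)} {n : ℕ}
    {x : C.X n} : x ∈ (Subcx.core A).mod n ↔ x ∈ A n ∧ ∀ m, (C.d n m).hom x ∈ A m := by
  simp [Subcx.core, Submodule.mem_iInf]

/-- The presentation of path homology. -/
def presPH (n : ℕ) :
    Pres (Digr.toQMet ⋙ RC.{u, v} K ⋙ FiltCx.forget K ℝ ⋙ HomologicalComplex.eval _ _ n)
      (PH K n) :=
  (cxPresOmega (K := K)).homology n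

/-- The cycles of `Ω_n(G)` are the numerators of `SH¹_{n,{n}}`. -/
theorem presPH_Z (n : ℕ) : (presPH.{u, v} K n).Z G =
    (presSH.{u, v} K 1 n {(n : ℝ)}).Z (Digr.toQMet.obj G) := by
  refine Submodule.ext fun x => ?_
  change x ∈ Subcx.relCycles (Subcx.core (allowed K G)) (Subcx.bot _) n ↔ _
  rw [presSH_singleton_Z]
  refine Subcx.mem_relCycles.trans (Iff.trans ?_ Subcx.mem_relCycles.symm)
  rw [F_digraph_eq_allowed]
  -- Only the differential into degree `m = n - 1` matters, and there the tuples have length at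
  -- least `n - 1`.
  have key : ∀ m, (((RC.{u, v} K).obj (Digr.toQMet.obj G)).cx.d n m).hom x ∈
      (((RC.{u, v} K).obj (Digr.toQMet.obj G)).FL
        (LowerSet.Iio ((n : ℝ) - ((1 : ℝ≥0) : ℝ)))).mod m ↔
      (((RC.{u, v} K).obj (Digr.toQMet.obj G)).cx.d n m).hom x ∈
        (Subcx.bot ((RC.{u, v} K).obj (Digr.toQMet.obj G)).cx).mod m := by
    intro m
    by_cases hm : m + 1 = n
    · rw [FL_Iio_digraph_eq_bot]
      · rfl
      · rw [← hm]
        simp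
    · exact iff_of_true
        (d_mem_of_forall_ne (C := ((RC.{u, v} K).obj (Digr.toQMet.obj G)).cx) hm _ x)
        (d_mem_of_forall_ne (C := ((RC.{u, v} K).obj (Digr.toQMet.obj G)).cx) hm _ x)
  simp only [key]
  refine and_congr_left fun h => mem_core.trans ⟨fun h' => h'.1, fun h' => ⟨h', fun m => ?_⟩⟩
  exact (congrArg (· ∈ allowed K G m) ((Submodule.mem_bot K).1 (h m))).mpr (zero_mem _)

/-- The boundaries of `Ω(G)` and the denominators of `SH¹_{n,{n}}` have the same intersection with
the numerators: an allowed `y` with allowed boundary belongs to `Ω_{n+1}(G)`. -/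
theorem presPH_B (n : ℕ) : (presPH.{u, v} K n).Z G ⊓ (presPH.{u, v} K n).B G =
    (presSH.{u, v} K 1 n {(n : ℝ)}).Z (Digr.toQMet.obj G) ⊓
      (presSH.{u, v} K 1 n {(n : ℝ)}).B (Digr.toQMet.obj G) := by
  rw [← presPH_Z]
  refine Submodule.ext fun x => and_congr_right fun hx => ?_
  have hx' : x ∈ allowed K G n := (mem_core.1 (Subcx.mem_relCycles.1 hx).1).1
  change x ∈ Subcx.relBoundaries (Subcx.core (allowed K G)) (Subcx.bot _) n ↔ _
  rw [presSH_singleton_B]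
  have e : (n : ℝ) + ((1 : ℝ≥0) : ℝ) = ((n + 1 : ℕ) : ℝ) := by simp
  rw [e]
  refine Subcx.mem_relBoundaries.trans (Iff.trans ?_ Subcx.mem_relBoundaries.symm)
  rw [F_digraph_eq_allowed, FL_Iio_digraph_eq_bot K G le_rfl]
  refine exists_congr fun y => and_congr_left fun h => mem_core.trans
    ⟨fun h' => h'.1, fun h' => ⟨h', fun m => ?_⟩⟩
  by_cases hm : m = n
  · subst hm
    have h1 := sub_eq_zero.1 ((Submodule.mem_bot K).1 h)
    exact (congrArg (· ∈ allowed K G m) h1).mp hx'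
  · exact d_mem_of_forall_ne (fun h' => hm (Nat.succ_injective h')) _ y

/-- Path homology is spectral homology `SH¹` on the diagonal. -/
def isoPH (n : ℕ) : (PH K n : Digr.{u} ⥤ ModuleCat.{max u v} K) ≅
    Digr.toQMet ⋙ SH K 1 n {(n : ℝ)} :=
  (presPH.{u, v} K n).iso ((presSH.{u, v} K 1 n {(n : ℝ)}).precomp Digr.toQMet)
    (fun G => presPH_Z K G n) (fun G => presPH_B K G n)

end

/-! ### Reachability homology -/

open Simplicial

section

variable {X Y : QMet.{u}}

/-- The functor that sends `X` to the nerve of the reachability preorder of `X`. -/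
abbrev reachNerve : QMet.{u} ⥤ SSet.{u} := Pre ⋙ preordToCat ⋙ nerveFunctor

/-- The simplex of the nerve of the reachability preorder with the vertices `x₀, …, xₙ`. -/
def reachSimplex {n : ℕ} (x : Fin (n + 1) → X.carrier) (hx : len X x < ∞) :
    (reachNerve.obj X) _⦋n⦌ :=
  letI := reachPreorder X
  (Fin.monotone_iff_le_succ.2 fun i =>
    (ENNReal.sum_lt_top.1 hx) i (Finset.mem_univ i) : Monotone x).functor

/-- The vertices of a simplex of the nerve of the reachability preorder. -/
def reachVertices {n : ℕ} (s : (reachNerve.obj X) _⦋n⦌) (i : Fin (n + 1)) : X.carrier :=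
  Functor.obj (C := Fin (n + 1)) (D := preordToCat.obj (Pre.obj X)) s i

theorem reachSimplex_ext {n : ℕ} {s t : (reachNerve.obj X) _⦋n⦌}
    (h : reachVertices s = reachVertices t) : s = t :=
  letI := reachPreorder X
  nerve.ext_of_isThin (C := X.carrier) h

theorem len_reachVertices {n : ℕ} (s : (reachNerve.obj X) _⦋n⦌) : len X (reachVertices s) < ∞ :=
  letI := reachPreorder X
  ENNReal.sum_lt_top.2 fun i _ =>
    (show ComposableArrows X.carrier n from s).monotone (Fin.castSucc_lt_succ (i := i)).le

theorem reachSimplex_reachVertices {n : ℕ} (s : (reachNerve.obj X) _⦋n⦌) :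
    reachSimplex (reachVertices s) (len_reachVertices s) = s :=
  reachSimplex_ext rfl

theorem δ_reachSimplex {n : ℕ} (x : Fin (n + 2) → X.carrier) (hx : len X x < ∞)
    (i : Fin (n + 2)) :
    (reachNerve.obj X).δ i (reachSimplex x hx) =
      reachSimplex (i.removeNth x) ((len_removeNth x i).trans_lt hx) :=
  reachSimplex_ext rfl

theorem map_reachSimplex (φ : X ⟶ Y) {n : ℕ} (x : Fin (n + 1) → X.carrier) (hx : len X x < ∞) :
    (reachNerve.map φ).app _ (reachSimplex x hx) =
      reachSimplex (fun i => φ.toFun (x i)) ((len_comp φ x).trans_lt hx) :=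
  reachSimplex_ext rfl

theorem mem_range_σ_reachNerve {n : ℕ} (s : (reachNerve.obj X) _⦋n + 1⦌) (i : Fin (n + 1)) :
    s ∈ Set.range ((reachNerve.obj X).σ i) ↔
      reachVertices s i.castSucc = reachVertices s i.succ := by
  have hσ : ∀ (t : (reachNerve.obj X) _⦋n⦌) (j : Fin (n + 2)),
      reachVertices ((reachNerve.obj X).σ i t) j = reachVertices t (i.predAbove j) :=
    fun _ _ => rfl
  constructor
  · rintro ⟨t, rfl⟩
    rw [hσ, hσ, Fin.predAbove_castSucc_self, Fin.predAbove_succ_self]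
  · intro h
    refine ⟨(reachNerve.obj X).δ i.castSucc s, reachSimplex_ext (funext fun j => ?_)⟩
    rw [hσ]
    change reachVertices s (i.castSucc.succAbove (i.predAbove j)) = _
    by_cases hj : j = i.castSucc
    · rw [hj, Fin.predAbove_castSucc_self, Fin.succAbove_castSucc_self, h]
    · rw [Fin.succAbove_predAbove hj]

/-- The nondegenerate simplices are the regular tuples. -/
theorem mem_nonDegenerate_reachNerve {n : ℕ} (s : (reachNerve.obj X) _⦋n⦌) :
    s ∈ (reachNerve.obj X).nonDegenerate n ↔ IsRegular X (reachVertices s) := by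
  rw [isRegular_iff, and_iff_left (len_reachVertices s)]
  cases n with
  | zero => simp
  | succ n =>
    rw [SSet.mem_nonDegenerate_iff_notMem_degenerate, SSet.degenerate_eq_iUnion_range_σ,
      Set.mem_iUnion, not_exists]
    exact forall_congr' fun i => not_congr (mem_range_σ_reachNerve s i)

variable (K : Type v) [CommRing K]

/-- The coefficients of reachability homology. -/
abbrev coeff : ModuleCat.{max u v} K := ModuleCat.of K (ULift.{u} K)

variable (X) in
/-- The normalized chains of the nerve of the reachability preorder. -/
abbrev reachNormalized : ChainComplex (ModuleCat.{max u v} K) ℕ :=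
  (reachNerve.obj X).normalizedChainComplex (coeff.{u, v} K)

/-- The class of a simplex in the normalized chains; it is zero for degenerate simplices. -/
def simplexClass {n : ℕ} (s : (reachNerve.obj X) _⦋n⦌) : (reachNormalized.{u, v} X K).X n :=
  ((reachNerve.obj X).ιNormalizedChainComplex (R := coeff.{u, v} K) s).hom (ULift.up 1)

theorem d_simplexClass {n : ℕ} (s : (reachNerve.obj X) _⦋n + 1⦌) :
    ((reachNormalized.{u, v} X K).d (n + 1) n).hom (simplexClass K s) =
      ∑ i : Fin (n + 2), (-1 : K) ^ (i : ℕ) • simplexClass K ((reachNerve.obj X).δ i s) := by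
  have h := congrArg (fun f => f.hom (ULift.up (1 : K)))
    ((reachNerve.obj X).ιNormalizedChainComplex_d (R := coeff.{u, v} K) s)
  refine h.trans ?_
  rw [ModuleCat.hom_sum, LinearMap.sum_apply]
  refine Finset.sum_congr rfl fun i _ => ?_
  rw [ModuleCat.hom_zsmul, LinearMap.smul_apply, ← Int.cast_smul_eq_zsmul K]
  simp [simplexClass]

theorem map_simplexClass (φ : X ⟶ Y) {n : ℕ} (s : (reachNerve.obj X) _⦋n⦌) :
    ((SSet.normalizedChainComplexMap (reachNerve.map φ) (coeff.{u, v} K)).f n).hom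
      (simplexClass K s) = simplexClass K ((reachNerve.map φ).app _ s) :=
  congrArg (fun f => f.hom (ULift.up (1 : K)))
    (SSet.ι_normalizedChainComplexMap_f (reachNerve.map φ) (coeff.{u, v} K) s)

variable (X) in
/-- The map that sends a generator of the reachability complex to the class of its simplex. -/
def toReachNormalized (n : ℕ) : (RTuple X n →₀ K) →ₗ[K] (reachNormalized.{u, v} X K).X n :=
  Finsupp.linearCombination K fun x =>
    simplexClass K (reachSimplex x.1 ((isRegular_iff x.1).1 x.2).2)

theorem toReachNormalized_tup {n : ℕ} (x : Fin (n + 1) → X.carrier) (hx : len X x < ∞) :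
    toReachNormalized.{u, v} X K n (tup K X x) = simplexClass K (reachSimplex x hx) := by
  by_cases h : IsRegular X x
  · rw [tup_of_regular K h, toReachNormalized, Finsupp.linearCombination_single, one_smul]
  · rw [tup_of_not_regular K h, map_zero, simplexClass, SSet.ιNormalizedChainComplex_eq_zero]
    · rfl
    · rw [SSet.mem_degenerate_iff_notMem_nonDegenerate]
      exact fun h' => h ((mem_nonDegenerate_reachNerve _).1 h')

variable (X) in
/-- The inverse of `toReachNormalized`, by the universal property of the normalized chains. -/
def ofReachNormalized (n : ℕ) :
    (reachNormalized.{u, v} X K).X n ⟶ ModuleCat.of K (RTuple X n →₀ K) :=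
  Limits.Cofan.IsColimit.desc
    ((reachNerve.obj X).isColimitCofanNormalizedChainComplex (coeff.{u, v} K) n)
    fun s => ModuleCat.ofHom ((Finsupp.lsingle
      (⟨reachVertices s.1, (mem_nonDegenerate_reachNerve s.1).1 s.2⟩ : RTuple X n)) ∘ₗ
        (ULift.moduleEquiv (R := K) (M := K)).toLinearMap)

theorem ofReachNormalized_simplexClass {n : ℕ} (s : (reachNerve.obj X) _⦋n⦌)
    (hs : IsRegular X (reachVertices s)) :
    (ofReachNormalized.{u, v} X K n).hom (simplexClass K s) = Finsupp.single ⟨_, hs⟩ 1 :=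
  congrArg (fun f : coeff.{u, v} K ⟶ ModuleCat.of K (RTuple X n →₀ K) => f.hom (ULift.up 1))
    (Limits.Cofan.IsColimit.fac
      ((reachNerve.obj X).isColimitCofanNormalizedChainComplex (coeff.{u, v} K) n) _
      ⟨s, (mem_nonDegenerate_reachNerve s).2 hs⟩)

variable (X) in
/-- The generators of the reachability complex are the nondegenerate simplices of the nerve. -/
def reachNormalizedXIso (n : ℕ) : (rcCx.{u, v} K X).X n ≅ (reachNormalized.{u, v} X K).X n where
  hom := ModuleCat.ofHom (toReachNormalized.{u, v} X K n)
  inv := ofReachNormalized.{u, v} X K n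
  hom_inv_id := by
    refine ModuleCat.hom_ext (Finsupp.lhom_ext' fun x => LinearMap.ext_ring ?_)
    have h := ((isRegular_iff x.1).1 x.2).2
    change (ofReachNormalized.{u, v} X K n).hom (toReachNormalized.{u, v} X K n
      (Finsupp.single x 1)) = Finsupp.single x 1
    rw [← tup_of_regular K x.2, toReachNormalized_tup K x.1 h,
      ofReachNormalized_simplexClass K (reachSimplex x.1 h) x.2, tup_of_regular K x.2]
    rfl
  inv_hom_id := by
    refine SSet.normalizedChainComplex_hom_ext _ fun s hs => ?_
    refine ModuleCat.hom_ext (LinearMap.ext fun c => ?_)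
    have hc : c = c.down • (ULift.up 1 : ULift.{u} K) := ULift.ext _ _ (mul_one c.down).symm
    rw [hc, map_smul, map_smul]
    congr 1
    have hs' := (mem_nonDegenerate_reachNerve s).1 hs
    change toReachNormalized.{u, v} X K n ((ofReachNormalized.{u, v} X K n).hom
      (simplexClass K s)) = simplexClass K s
    rw [ofReachNormalized_simplexClass K s hs', ← tup_of_regular K hs',
      toReachNormalized_tup K _ (len_reachVertices s), reachSimplex_reachVertices]

variable (X) in
/-- The reachability complex is the complex of normalized chains of the nerve. -/
def rcCxIso : rcCx.{u, v} K X ≅ reachNormalized.{u, v} X K :=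
  HomologicalComplex.Hom.isoOfComponents (fun n => reachNormalizedXIso.{u, v} X K n) (by
    rintro _ n rfl
    rw [rcCx_d]
    refine ModuleCat.hom_ext (Finsupp.lhom_ext' fun x => LinearMap.ext_ring ?_)
    have h := ((isRegular_iff x.1).1 x.2).2
    change ((reachNormalized.{u, v} X K).d (n + 1) n).hom
      (toReachNormalized.{u, v} X K (n + 1) (Finsupp.single x 1)) =
      toReachNormalized.{u, v} X K n (rcD K X n (Finsupp.single x 1))
    rw [← tup_of_regular K x.2, toReachNormalized_tup K x.1 h, d_simplexClass, rcD_tup K h, map_sum]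
    refine Finset.sum_congr rfl fun i _ => ?_
    rw [map_smul, toReachNormalized_tup K _ ((len_removeNth x.1 i).trans_lt h), δ_reachSimplex])

/-- The reachability complex is naturally the complex of normalized chains of the nerve. -/
def rcNormalizedIso : RC.{u, v} K ⋙ FiltCx.forget K ℝ ≅
    reachNerve ⋙ SSet.normalizedChainComplexFunctorObj (coeff.{u, v} K) :=
  NatIso.ofComponents (fun X => rcCxIso.{u, v} X K) fun {X Y} φ =>
    HomologicalComplex.hom_ext _ _ fun n => by
      refine ModuleCat.hom_ext (Finsupp.lhom_ext' fun x => LinearMap.ext_ring ?_)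
      have h := ((isRegular_iff x.1).1 x.2).2
      change toReachNormalized.{u, v} Y K n (rcMap K φ n (Finsupp.single x 1)) =
        ((SSet.normalizedChainComplexMap (reachNerve.map φ) (coeff.{u, v} K)).f n).hom
          (toReachNormalized.{u, v} X K n (Finsupp.single x 1))
      rw [← tup_of_regular K x.2, toReachNormalized_tup K x.1 h, map_simplexClass, rcMap_tup K φ h,
        toReachNormalized_tup K _ ((len_comp φ x.1).trans_lt h), map_reachSimplex]

/-- The homology of a simplicial set is the homology of its normalized chains. -/
def sSetHomologyIso (n : ℕ) : SSet.homologyFunctor.{u} (coeff.{u, v} K) n ≅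
    SSet.normalizedChainComplexFunctorObj (coeff.{u, v} K) ⋙ Hn.{v, max u v} K n :=
  NatIso.ofComponents
    (fun S => (S.homotopyEquivNormalizedChainComplex (coeff.{u, v} K)).toHomologyIso n)
    fun {S T} f => by
      refine (HomologicalComplex.homologyMap_comp _ _ n).symm.trans (Eq.trans ?_
        (HomologicalComplex.homologyMap_comp _ _ n))
      exact congrArg (fun g => HomologicalComplex.homologyMap g n)
        (SSet.toNormalizedChainComplex_normalizedChainComplexMap f (coeff.{u, v} K)).symm

/-- Reachability homology is spectral homology of the real line. -/
def isoRH (r : ℝ≥0) (n : ℕ) :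
    (RH K n : QMet.{u} ⥤ ModuleCat.{max u v} K) ≅ SH K r n Set.univ :=
  Functor.isoWhiskerLeft reachNerve (sSetHomologyIso.{u, v} K n) ≪≫
    Functor.isoWhiskerRight (rcNormalizedIso.{u, v} K).symm (Hn.{v, max u v} K n) ≪≫
      isoSHUniv K r n

end

end SpectralHomology

end

theorem theorem4p9 (K : Type v) [CommRing K] :
    -- magnitude homology
    (∀ (n : ℕ) (ℓ : ℝ),
      Nonempty ((MH K n ℓ : QMet.{u} ⥤ ModuleCat.{max u v} K) ≅ SH K 0 n {ℓ}) ∧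
      ∀ r : ℝ≥0,
        IsSubquotient (SH K r n {ℓ}) (MH K n ℓ : QMet.{u} ⥤ ModuleCat.{max u v} K) ∧
        QMet.HomotopyInvariant r (SH K r n {ℓ} : QMet.{u} ⥤ ModuleCat.{max u v} K)) ∧
    -- blurred magnitude homology
    (∀ n : ℕ,
      Nonempty ((BMH K n : QMet.{u} ⥤ ℝ ⥤ ModuleCat.{max u v} K) ≅ PSH K 0 n) ∧
      ∀ r : ℝ≥0,
        IsSubquotient (PSH K r n) (BMH K n : QMet.{u} ⥤ ℝ ⥤ ModuleCat.{max u v} K) ∧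
        QMet.HomotopyInvariant r (PSH K r n : QMet.{u} ⥤ ℝ ⥤ ModuleCat.{max u v} K)) ∧
    -- reachability homology
    (∀ (n : ℕ) (r : ℝ≥0),
      Nonempty ((RH K n : QMet.{u} ⥤ ModuleCat.{max u v} K) ≅ SH K r n Set.univ)) ∧
    -- pages of the magnitude-path spectral sequence
    (∀ (r : ℕ) (hr : 1 ≤ r) (n : ℕ) (ℓ : ℤ),
      Nonempty ((MPSS K r hr n ℓ : Digr.{u} ⥤ ModuleCat.{max u v} K) ≅
        Digr.toQMet ⋙ SH K ((r - 1 : ℕ) : ℝ≥0) n {(ℓ : ℝ)})) ∧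
    -- path homology
    (∀ n : ℕ,
      Nonempty ((PH K n : Digr.{u} ⥤ ModuleCat.{max u v} K) ≅
        Digr.toQMet ⋙ SH K 1 n {(n : ℝ)})) := by
  exact ⟨fun n ℓ => ⟨⟨isoMH K n ℓ⟩, fun r =>
      ⟨isSubquotient_SH_MH K r n ℓ, homotopyInvariant_SH K r n _⟩⟩,
    fun n => ⟨⟨isoBMHPSH K n⟩, fun r =>
      ⟨isSubquotient_PSH_BMH K r n, homotopyInvariant_PSH K r n⟩⟩,
    fun n r => ⟨isoRH K r n⟩,
    fun r hr n ℓ => ⟨isoMPSS K r hr n ℓ⟩,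
    fun n => ⟨isoPH K n⟩⟩
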